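/- Let $\mathcal A$ be a unital C*-algebra, let $\mathcal E$ be a left operator $\mathcal A$-space (an operator space with a unital, completely contractive left $\mathcal A$-module action), and let $\mathcal S$ be an operator $\mathcal A$-system, i.e. an operator system with unit $e$ that is a unital $\mathcal A$-bimodule such that $a^*\cdot M_m(\mathcal S)^+\cdot a\subseteq M_n(\mathcal S)^+$ for all $a\in M_{m,n}(\mathcal A)$ and all $m,n$, and such that $a\cdot e=e\cdot a$ and $(a\cdot s)^*=s^*\cdot a^*$ for all $a\in\mathcal A$, $s\in\mathcal S$. Let $\mathcal E^*=\{x^*: x\in\mathcal E\}$ be the adjoint operator space, with $\|(x_{i,j}^*)_{i,j}\|=\|(x_{j,i})_{i,j}\|$ and $x^*\cdot a=(a^*\cdot x)^*$. Let $H$ be a Hilbert space and let $\theta\colon\mathcal E^*\times\mathcal S\times\mathcal E\to\mathcal B(H)$ be a trilinear map which is - completely bounded: $\|\theta\|_{\rm cb}=\sup_n\|\theta\colon M_n(\mathcal E^*)\times M_n(\mathcal S)\times M_n(\mathcal E)\to M_n(\mathcal B(H))\|<\infty$, where $\theta$ is extended to matrices by $\theta(y,s,x)_{i,j}=\sum_{p,q}\theta(y_{i,p},s_{p,q},x_{q,j})$;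 - completely positive: $\theta(x^*,s,x)\in M_n(\mathcal B(H))^+$ for all $m,n$, all $x\in M_{m,n}(\mathcal E)$ and all $s\in M_m(\mathcal S)^+$; - $\mathcal A$-balanced: $\theta(y^*,a\cdot s\cdot b,x)=\theta(y^*\cdot a,s,b\cdot x)$ for all $x,y\in\mathcal E$, $s\in\mathcal S$, $a,b\in\mathcal A$. Then the following hold. (i) There exist a Hilbert space $K$, a completely bounded linear map $\phi\colon\mathcal E\to\mathcal B(H,K)$ and a unital completely positive map $\psi\colon\mathcal S\to\mathcal B(K)$ such that $(\phi,\psi)$ is $\mathcal A$-admissible, i.e. $$\psi(s\cdot a)\phi(x)=\psi(s)\phi(a\cdot x),\qquad x\in\mathcal E,\ s\in\mathcal S,\ a\in\mathcal A,$$ and $$\theta(y^*,s,x)=\phi(y)^*\psi(s)\phi(x),\qquad x,y\in\mathcal E,\ s\in\mathcal S.$$ Moreover, $\phi$ and $\psi$ can be chosen so that $\|\theta\|_{\rm cb}=\|\phi\|_{\rm cb}^2$. (ii) If, in addition, $\mathcal A\subseteq\mathcal S$ (that is, the map $a\mapsto a\cdot e$ is injective, and $\mathcal A$ is identified with its image in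 $\mathcal S$), then $K$, $\phi$ and $\psi$ as in (i), including the norm equality, can be chosen so that $\pi:=\psi|_{\mathcal A}$ is a unital $*$-representation of $\mathcal A$ on $K$ with $\phi(a\cdot x)=\pi(a)\phi(x)$, $\psi(a\cdot s)=\pi(a)\psi(s)$ and $\psi(s\cdot a)=\psi(s)\pi(a)$ for all $a\in\mathcal A$, $x\in\mathcal E$, $s\in\mathcal S$. (iii) If $\mathcal S$ is a unital C*-algebra (with its canonical operator system structure), then $K$, $\phi$ and $\psi$ as in (i), including the norm equality, can be chosen so that $\psi$ is a $*$-representation. -/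

import Mathlib

open scoped ENNReal NNReal

noncomputable section

namespace OpSpace

/-! ### Matrix norms and operator spaces -/

/-- A family of real-valued functions on the spaces `M_n(X)`, `n ∈ ℕ`. -/
class MatrixNorm (X : Type*) where
  /-- the `n`-th matrix norm -/
  mnorm : ∀ {n : ℕ}, Matrix (Fin n) (Fin n) X → ℝ

/-- The product `α · x · β` of a matrix `x` over a complex vector space by scalar matrices. -/
def scalarMul {X : Type*} [AddCommMonoid X] [Module ℂ X] {m n k l : ℕ}
    (α : Matrix (Fin m) (Fin k) ℂ) (x : Matrix (Fin k) (Fin l) X)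
    (β : Matrix (Fin l) (Fin n) ℂ) : Matrix (Fin m) (Fin n) X :=
  Matrix.of fun i j => ∑ p, ∑ q, (α i p * β q j) • x p q

/-- A `2 × 2` block matrix with blocks in `M_{n,n}`, `M_{n,m}`, `M_{m,n}`, `M_{m,m}`, regarded as
an element of `M_{n+m}`. -/
def blockMat {X : Type*} {n m : ℕ} (a : Matrix (Fin n) (Fin n) X) (b : Matrix (Fin n) (Fin m) X)
    (c : Matrix (Fin m) (Fin n) X) (d : Matrix (Fin m) (Fin m) X) :
    Matrix (Fin (n + m)) (Fin (n + m)) X :=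
  Matrix.reindex finSumFinEquiv finSumFinEquiv (Matrix.fromBlocks a b c d)

section OperatorSpaces

open scoped Matrix.Norms.L2Operator

/-- (Abstract) operator spaces: a complex vector space with a norm on each `M_n(X)`, subject to
Ruan's axioms. The norm of a scalar matrix is its operator norm between Euclidean spaces. -/
class OperatorSpace (X : Type*) [AddCommGroup X] [Module ℂ X] extends MatrixNorm X where
  mnorm_add_le : ∀ {n : ℕ} (x y : Matrix (Fin n) (Fin n) X), mnorm (x + y) ≤ mnorm x + mnorm y
  mnorm_smul : ∀ {n : ℕ} (c : ℂ) (x : Matrix (Fin n) (Fin n) X), mnorm (c • x) = ‖c‖ * mnorm x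
  eq_zero_of_mnorm : ∀ {n : ℕ} (x : Matrix (Fin n) (Fin n) X), mnorm x = 0 → x = 0
  mnorm_scalarMul_le : ∀ {m n : ℕ} (α : Matrix (Fin n) (Fin m) ℂ) (x : Matrix (Fin m) (Fin m) X)
    (β : Matrix (Fin m) (Fin n) ℂ),
    mnorm (scalarMul α x β) ≤ ‖α‖ * mnorm x * ‖β‖
  mnorm_direct_sum : ∀ {n m : ℕ} (x : Matrix (Fin n) (Fin n) X) (y : Matrix (Fin m) (Fin m) X),
    mnorm (blockMat x 0 0 y) = max (mnorm x) (mnorm y)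

end OperatorSpaces

/-! ### The adjoint space -/

/-- The adjoint space `E*` of a complex vector space `E`; its elements are the symbols `x*` with
`x ∈ E`, see `adj`. -/
def AdjointSpace (E : Type*) : Type _ := E

instance {E : Type*} [AddCommGroup E] : AddCommGroup (AdjointSpace E) :=
  inferInstanceAs (AddCommGroup E)

/-- The additive bijection `x ↦ x*` from `E` onto `E*`. -/
def adj {E : Type*} [AddCommGroup E] : E ≃+ AdjointSpace E := AddEquiv.refl E

/-- `c · x* = (c̄ · x)*`. -/
instance {E : Type*} [AddCommGroup E] [Module ℂ E] : Module ℂ (AdjointSpace E) where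
  smul c y := adj (star c • adj.symm y)
  one_smul y := by
    change adj (star (1 : ℂ) • adj.symm y) = y
    simp
  mul_smul c d y := by
    change adj (star (c * d) • adj.symm y) = adj (star c • adj.symm (adj (star d • adj.symm y)))
    simp [mul_smul]
  smul_zero c := by
    change adj (star c • adj.symm 0) = 0
    simp
  smul_add c y z := by
    change adj (star c • adj.symm (y + z)) = adj (star c • adj.symm y) + adj (star c • adj.symm z)
    simp
  add_smul c d y := by
    change adj (star (c + d) • adj.symm y) = adj (star c • adj.symm y) + adj (star d • adj.symm y)
    simp [add_smul]
  zero_smul y := by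
    change adj (star (0 : ℂ) • adj.symm y) = 0
    simp

/-- If `E` is a left `A`-module, then `E*` is a right `A`-module: `x* · a = (a* · x)*`. -/
instance {A E : Type*} [Ring A] [StarRing A] [AddCommGroup E] [Module A E] :
    Module Aᵐᵒᵖ (AdjointSpace E) where
  smul a y := adj (star a.unop • adj.symm y)
  one_smul y := by
    change adj (star (1 : A) • adj.symm y) = y
    simp
  mul_smul c d y := by
    change adj (star (d.unop * c.unop) • adj.symm y) =
      adj (star c.unop • adj.symm (adj (star d.unop • adj.symm y)))
    simp [mul_smul]
  smul_zero c := by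
    change adj (star c.unop • adj.symm 0) = 0
    simp
  smul_add c y z := by
    change adj (star c.unop • adj.symm (y + z)) =
      adj (star c.unop • adj.symm y) + adj (star c.unop • adj.symm z)
    simp
  add_smul c d y := by
    change adj (star (c.unop + d.unop) • adj.symm y) =
      adj (star c.unop • adj.symm y) + adj (star d.unop • adj.symm y)
    simp [add_smul]
  zero_smul y := by
    change adj (star (0 : A) • adj.symm y) = 0
    simp

/-- For `x ∈ M_{m,n}(E)`, the matrix `x* ∈ M_{n,m}(E*)` with entries `(x*)_{i,j} = (x_{j,i})*`. -/
def matAdj {E : Type*} [AddCommGroup E] {m n : ℕ} (x : Matrix (Fin m) (Fin n) E) :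
    Matrix (Fin n) (Fin m) (AdjointSpace E) :=
  Matrix.of fun i j => adj (x j i)

/-- The matrix norms of `E*`: `‖(x_{i,j}*)‖ = ‖(x_{j,i})‖`. -/
instance {E : Type*} [AddCommGroup E] [MatrixNorm E] : MatrixNorm (AdjointSpace E) where
  mnorm y := MatrixNorm.mnorm (Matrix.of fun i j => adj.symm (y j i))

/-! ### Operators between Hilbert spaces -/

section Operators

variable {H K : Type*} [NormedAddCommGroup H] [InnerProductSpace ℂ H]
  [NormedAddCommGroup K] [InnerProductSpace ℂ K]

/-- A matrix of operators in `M_{m,n}(B(H,K))` as an operator from `Hⁿ` to `Kᵐ`. -/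
def toOp {m n : ℕ} (T : Matrix (Fin m) (Fin n) (H →L[ℂ] K)) :
    PiLp 2 (fun _ : Fin n => H) →L[ℂ] PiLp 2 (fun _ : Fin m => K) :=
  (PiLp.continuousLinearEquiv 2 ℂ (fun _ : Fin m => K)).symm.toContinuousLinearMap ∘L
    ContinuousLinearMap.pi fun i => ∑ j, T i j ∘L PiLp.proj 2 (fun _ : Fin n => H) j

theorem toOp_apply {m n : ℕ} (T : Matrix (Fin m) (Fin n) (H →L[ℂ] K))
    (ξ : PiLp 2 (fun _ : Fin n => H)) (i : Fin m) : toOp T ξ i = ∑ j, T i j (ξ j) := by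
  simp [toOp]

/-- The norm of `M_n(B(H,K)) = B(Hⁿ,Kⁿ)`. -/
instance : MatrixNorm (H →L[ℂ] K) where
  mnorm T := ‖toOp T‖

end Operators

/-! ### Operator systems -/

/-- A family of subsets of the spaces `M_n(X)`, `n ∈ ℕ`. -/
class MatrixCone (X : Type*) where
  /-- the `n`-th cone `M_n(X)⁺` -/
  cone : ∀ n : ℕ, Set (Matrix (Fin n) (Fin n) X)

/-- `M_n(B(K))⁺` consists of the matrices that are positive operators on `Kⁿ`. -/
instance {K : Type*} [NormedAddCommGroup K] [InnerProductSpace ℂ K] :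
    MatrixCone (K →L[ℂ] K) where
  cone _ := {T | (toOp T).IsPositive}

/-- (Abstract) operator systems: matrix ordered `*`-vector spaces with an Archimedean matrix order
unit. The involution of `M_n(S)` is `Matrix.conjTranspose`. -/
class OperatorSystem (S : Type*) [AddCommGroup S] [Module ℂ S] [StarAddMonoid S] [StarModule ℂ S]
    extends MatrixCone S where
  cone_hermitian : ∀ {n : ℕ} {x : Matrix (Fin n) (Fin n) S}, x ∈ cone n → x.conjTranspose = x
  cone_inter_neg : ∀ n : ℕ, {x | x ∈ cone n ∧ -x ∈ cone n} = {0}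
  cone_add : ∀ {n : ℕ} {x y : Matrix (Fin n) (Fin n) S}, x ∈ cone n → y ∈ cone n → x + y ∈ cone n
  cone_smul : ∀ {n : ℕ} {x : Matrix (Fin n) (Fin n) S} {r : ℝ}, 0 ≤ r → x ∈ cone n →
    (r : ℂ) • x ∈ cone n
  cone_compatible : ∀ {m n : ℕ} (α : Matrix (Fin m) (Fin n) ℂ) {x : Matrix (Fin m) (Fin m) S},
    x ∈ cone m → scalarMul α.conjTranspose x α ∈ cone n
  /-- the Archimedean matrix order unit -/
  unit : S
  star_unit : star unit = unit
  order_unit : ∀ {n : ℕ} {x : Matrix (Fin n) (Fin n) S}, x.conjTranspose = x →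
    ∃ r : ℝ, 0 < r ∧ (r : ℂ) • Matrix.diagonal (fun _ => unit) + x ∈ cone n
  archimedean : ∀ {n : ℕ} {x : Matrix (Fin n) (Fin n) S}, x.conjTranspose = x →
    (∀ r : ℝ, 0 < r → (r : ℂ) • Matrix.diagonal (fun _ => unit) + x ∈ cone n) → x ∈ cone n

section Systems

variable {S : Type*} [AddCommGroup S] [Module ℂ S] [StarAddMonoid S] [StarModule ℂ S]
  [OperatorSystem S]

/-- The matrix norms of an operator system: `‖x‖` is the infimum of all `r ≥ 0` such that
`[[r (e ⊗ I_n), x], [x*, r (e ⊗ I_n)]]` is in `M_{2n}(S)⁺`. -/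
instance : MatrixNorm S where
  mnorm {n} x := sInf {r : ℝ | 0 ≤ r ∧
    blockMat ((r : ℂ) • Matrix.diagonal fun _ : Fin n => (OperatorSystem.unit : S)) x
      x.conjTranspose ((r : ℂ) • Matrix.diagonal fun _ : Fin n => (OperatorSystem.unit : S)) ∈
      MatrixCone.cone (n + n)}

end Systems

/-- `M_n(C)⁺` for a C*-algebra `C`: the elements `y* y` with `y ∈ M_n(C)`. -/
def cstarCone (C : Type*) [CStarAlgebra C] (n : ℕ) : Set (Matrix (Fin n) (Fin n) C) :=
  {x | ∃ y : Matrix (Fin n) (Fin n) C, x = y.conjTranspose * y}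

/-- `j : S → C` identifies the operator system `S` with the unital C*-algebra `C`, viewed as an
operator system: `j` is a unital complete order isomorphism. -/
structure IsCStarIdentification {S C : Type*} [AddCommGroup S] [Module ℂ S] [StarAddMonoid S]
    [StarModule ℂ S] [OperatorSystem S] [CStarAlgebra C] (j : S ≃ₗ[ℂ] C) : Prop where
  map_unit : j OperatorSystem.unit = 1
  map_star : ∀ s : S, j (star s) = star (j s)
  mem_cone_iff : ∀ (n : ℕ) (x : Matrix (Fin n) (Fin n) S),
    x ∈ MatrixCone.cone n ↔ x.map j ∈ cstarCone C n

/-! ### Operator modules -/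

/-- The product of a matrix over `A` with a matrix over a left `A`-module. -/
def leftMul {A E : Type*} [AddCommMonoid E] [SMul A E] {m n k : ℕ}
    (a : Matrix (Fin m) (Fin k) A) (x : Matrix (Fin k) (Fin n) E) : Matrix (Fin m) (Fin n) E :=
  Matrix.of fun i j => ∑ p, a i p • x p j

/-- Left operator `A`-spaces: the (unital) module action is completely contractive. -/
class LeftOperatorSpace (A E : Type*) [CStarAlgebra A] [PartialOrder A] [StarOrderedRing A]
    [AddCommGroup E] [Module ℂ E] [OperatorSpace E] [Module A E]
    [IsScalarTower ℂ A E] : Prop where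
  mnorm_leftMul_le : ∀ {n : ℕ} (a : Matrix (Fin n) (Fin n) A) (x : Matrix (Fin n) (Fin n) E),
    MatrixNorm.mnorm (leftMul a x) ≤ ‖CStarMatrix.ofMatrix a‖ * MatrixNorm.mnorm x

/-- The matrix `a* · x · a` over an `A`-bimodule; the right action is the action of `Aᵐᵒᵖ`. -/
def conjMul {A S : Type*} [Star A] [AddCommMonoid S] [SMul A S] [SMul Aᵐᵒᵖ S] {m n : ℕ}
    (a : Matrix (Fin m) (Fin n) A) (x : Matrix (Fin m) (Fin m) S) : Matrix (Fin n) (Fin n) S :=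
  Matrix.of fun i j => ∑ p, ∑ q, star (a p i) • (MulOpposite.op (a q j) • x p q)

/-- (Abstract) operator `A`-systems: an operator system that is a (unital) `A`-bimodule with
`a* · M_m(S)⁺ · a ⊆ M_n(S)⁺`, `a · e = e · a` and `(a · s)* = s* · a*`. -/
class OperatorASystem (A S : Type*) [CStarAlgebra A] [AddCommGroup S] [Module ℂ S]
    [StarAddMonoid S] [StarModule ℂ S] [OperatorSystem S] [Module A S] [Module Aᵐᵒᵖ S]
    [IsScalarTower ℂ A S] [IsScalarTower ℂ Aᵐᵒᵖ S] [SMulCommClass A Aᵐᵒᵖ S] : Prop where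
  conjMul_mem : ∀ {m n : ℕ} (a : Matrix (Fin m) (Fin n) A) {x : Matrix (Fin m) (Fin m) S},
    x ∈ MatrixCone.cone m → conjMul a x ∈ MatrixCone.cone n
  smul_unit : ∀ a : A, a • (OperatorSystem.unit : S) = MulOpposite.op a • OperatorSystem.unit
  star_smul : ∀ (a : A) (s : S), star (a • s) = MulOpposite.op (star a) • star s

/-! ### Completely bounded and completely positive linear maps -/

section LinearMaps

variable {X Y : Type*} [AddCommGroup X] [Module ℂ X] [AddCommGroup Y] [Module ℂ Y]

/-- The norm of `φ⁽ⁿ⁾ : M_n(X) → M_n(Y)`. It is `∞` if `φ⁽ⁿ⁾` is not bounded. -/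
def levelNorm [MatrixNorm X] [MatrixNorm Y] (n : ℕ) (φ : X →ₗ[ℂ] Y) : ℝ≥0∞ :=
  ⨅ (c : ℝ≥0) (_ : ∀ x : Matrix (Fin n) (Fin n) X,
    MatrixNorm.mnorm (x.map φ) ≤ c * MatrixNorm.mnorm x), (c : ℝ≥0∞)

/-- The completely bounded norm of a linear map. -/
def cbNorm [MatrixNorm X] [MatrixNorm Y] (φ : X →ₗ[ℂ] Y) : ℝ≥0∞ :=
  ⨆ n : ℕ, levelNorm n φ

/-- Completely bounded linear maps. -/
def IsCB [MatrixNorm X] [MatrixNorm Y] (φ : X →ₗ[ℂ] Y) : Prop := cbNorm φ < ∞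

/-- Completely positive linear maps. -/
def IsCP [Star X] [Star Y] [MatrixCone X] [MatrixCone Y] (φ : X →ₗ[ℂ] Y) : Prop :=
  (∀ x, φ (star x) = star (φ x)) ∧
    ∀ (n : ℕ) (x : Matrix (Fin n) (Fin n) X), x ∈ MatrixCone.cone n → x.map φ ∈ MatrixCone.cone n

end LinearMaps

/-- Unital completely positive maps from an operator system into `B(K)`. -/
def IsUCP {S K : Type*} [AddCommGroup S] [Module ℂ S] [StarAddMonoid S] [StarModule ℂ S]
    [OperatorSystem S] [NormedAddCommGroup K] [InnerProductSpace ℂ K] [CompleteSpace K]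
    (ψ : S →ₗ[ℂ] (K →L[ℂ] K)) : Prop :=
  IsCP ψ ∧ ψ OperatorSystem.unit = 1

/-! ### Trilinear maps -/

section Trilinear

variable {X Y Z W : Type*} [AddCommGroup X] [Module ℂ X] [AddCommGroup Y] [Module ℂ Y]
  [AddCommGroup Z] [Module ℂ Z] [AddCommGroup W] [Module ℂ W]

/-- The matrix extension `M_{k₁,k₂}(X) × M_{k₂,k₃}(Y) × M_{k₃,k₄}(Z) → M_{k₁,k₄}(W)` of a trilinear
map. -/
def triAmp (θ : X →ₗ[ℂ] Y →ₗ[ℂ] Z →ₗ[ℂ] W) {k₁ k₂ k₃ k₄ : ℕ} (x : Matrix (Fin k₁) (Fin k₂) X)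
    (y : Matrix (Fin k₂) (Fin k₃) Y) (z : Matrix (Fin k₃) (Fin k₄) Z) :
    Matrix (Fin k₁) (Fin k₄) W :=
  Matrix.of fun i j => ∑ p, ∑ q, θ (x i p) (y p q) (z q j)

variable [MatrixNorm X] [MatrixNorm Y] [MatrixNorm Z] [MatrixNorm W]

/-- The norm of `θ : M_n(X) × M_n(Y) × M_n(Z) → M_n(W)`. It is `∞` if this map is not bounded. -/
def triLevelNorm (n : ℕ) (θ : X →ₗ[ℂ] Y →ₗ[ℂ] Z →ₗ[ℂ] W) : ℝ≥0∞ :=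
  ⨅ (c : ℝ≥0) (_ : ∀ (x : Matrix (Fin n) (Fin n) X) (y : Matrix (Fin n) (Fin n) Y)
    (z : Matrix (Fin n) (Fin n) Z), MatrixNorm.mnorm (triAmp θ x y z) ≤
      c * MatrixNorm.mnorm x * MatrixNorm.mnorm y * MatrixNorm.mnorm z), (c : ℝ≥0∞)

/-- The completely bounded norm of a trilinear map. -/
def triCBNorm (θ : X →ₗ[ℂ] Y →ₗ[ℂ] Z →ₗ[ℂ] W) : ℝ≥0∞ :=
  ⨆ n : ℕ, triLevelNorm n θ

/-- Completely bounded trilinear maps. -/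
def IsTriCB (θ : X →ₗ[ℂ] Y →ₗ[ℂ] Z →ₗ[ℂ] W) : Prop := triCBNorm θ < ∞

end Trilinear

section Main

variable {A E S : Type*} [CStarAlgebra A] [AddCommGroup E] [Module ℂ E] [Module A E]
  [AddCommGroup S] [Module ℂ S] [StarAddMonoid S] [StarModule ℂ S] [OperatorSystem S]
  [Module A S] [Module Aᵐᵒᵖ S]

/-- Completely positive trilinear maps `E* × S × E → T`: `θ(x*, s, x) ∈ M_n(T)⁺` for all
`x ∈ M_{m,n}(E)` and `s ∈ M_m(S)⁺`. -/
def IsTriCP {T : Type*} [AddCommGroup T] [Module ℂ T] [MatrixCone T]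
    (θ : AdjointSpace E →ₗ[ℂ] S →ₗ[ℂ] E →ₗ[ℂ] T) : Prop :=
  ∀ (n m : ℕ) (x : Matrix (Fin m) (Fin n) E) (s : Matrix (Fin m) (Fin m) S),
    s ∈ MatrixCone.cone m → triAmp θ (matAdj x) s x ∈ MatrixCone.cone n

variable (A) in
/-- `A`-balanced trilinear maps: `θ(y*, a · s · b, x) = θ(y* · a, s, b · x)`. -/
def IsBalanced {T : Type*} [AddCommGroup T] [Module ℂ T]
    (θ : AdjointSpace E →ₗ[ℂ] S →ₗ[ℂ] E →ₗ[ℂ] T) : Prop :=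
  ∀ (x y : E) (s : S) (a b : A),
    θ (adj y) (a • (MulOpposite.op b • s)) x = θ (MulOpposite.op a • adj y) s (b • x)

variable {H K : Type*} [NormedAddCommGroup H] [InnerProductSpace ℂ H] [CompleteSpace H]
  [NormedAddCommGroup K] [InnerProductSpace ℂ K] [CompleteSpace K]

variable (A) in
/-- `A`-admissible pairs: `φ : E → B(H,K)` is completely bounded, `ψ : S → B(K)` is unital
completely positive, and `ψ(s · a) φ(x) = ψ(s) φ(a · x)`. -/
def IsAdmissible [OperatorSpace E] (φ : E →ₗ[ℂ] (H →L[ℂ] K)) (ψ : S →ₗ[ℂ] (K →L[ℂ] K)) : Prop :=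
  IsCB φ ∧ IsUCP ψ ∧
    ∀ (s : S) (a : A) (x : E), ψ (MulOpposite.op a • s) ∘L φ x = ψ s ∘L φ (a • x)

/-- `θ = φ* · ψ · φ`, that is, `θ(y*, s, x) = φ(y)* ψ(s) φ(x)`. -/
def FactorsAs (θ : AdjointSpace E →ₗ[ℂ] S →ₗ[ℂ] E →ₗ[ℂ] (H →L[ℂ] H))
    (φ : E →ₗ[ℂ] (H →L[ℂ] K)) (ψ : S →ₗ[ℂ] (K →L[ℂ] K)) : Prop :=
  ∀ (y : E) (s : S) (x : E),
    θ (adj y) s x = ContinuousLinearMap.adjoint (φ y) ∘L ψ s ∘L φ x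

/-- `(φ, π)` is an `A`-representation of the left operator `A`-space `E`. -/
def IsSpaceRep [OperatorSpace E] (φ : E →ₗ[ℂ] (H →L[ℂ] K)) (π : A →⋆ₐ[ℂ] (K →L[ℂ] K)) : Prop :=
  IsCB φ ∧ ∀ (a : A) (x : E), φ (a • x) = π a ∘L φ x

/-- `(ψ, π)` is an `A`-representation of the operator `A`-system `S`. -/
def IsSystemRep (ψ : S →ₗ[ℂ] (K →L[ℂ] K)) (π : A →⋆ₐ[ℂ] (K →L[ℂ] K)) : Prop :=
  IsCP ψ ∧ ∀ (a : A) (s : S), ψ (a • s) = π a ∘L ψ s ∧ ψ (MulOpposite.op a • s) = ψ s ∘L π a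

end Main

end OpSpace

end

open OpSpace

universe uA uE uS uH

/-!
The proof is a Gelfand–Naimark–Segal construction on `E ⊗ H`. Complete positivity of `θ` says that
the forms `(y ⊗ η, x ⊗ ξ) ↦ ⟪η, θ(y*, s, x) ξ⟫` are completely positive in `s`. The form for
`s = e` is a semi-inner product; let `K` be the completion and `φ(x) ξ` the class of `x ⊗ ξ`.
Positivity at `[[r e, s], [s*, r e]]` shows that the form for `s` is bounded, hence is given by an
operator `ψ(s)` on `K` (`exists_ucp_of_form`, `exists_dilation`). By construction
`φ(y)* ψ(s) φ(x) = θ(y*, s, x)`, and since the vectors `φ(x) ξ` span a dense subspace, an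
identity between operators on `K` may be tested between operators `φ(y)*` and `φ(x)`. There,
admissibility is the hypothesis that `θ` is balanced. The equality of norms holds for every such factorisation
(`FactorsAs.isCB_and_norm_eq`).

On this minimal space `ψ(a · e) φ(x) = φ(a · x)`, which makes `a ↦ ψ(a · e)` a representation with
the required module properties (`IsAdmissible.exists_rep`).

If `S` is a C*-algebra, `ψ` is dilated to a representation by Stinespring's theorem
(`IsUCP.exists_stinespring`), which is the same construction applied to
`(d, c) ↦ ψ(d* s c)`. Admissibility survives because the action of `A` on the C*-algebra `S` is
multiplication by `a · e` (`IsCStarIdentification.map_op_smul`), so it commutes with left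
multiplication.
-/

noncomputable section

namespace OpSpace

open scoped ComplexOrder InnerProductSpace TensorProduct

universe u v

/-! ### Hilbert spaces and operators from sesquilinear forms -/

theorem exists_hilbert_of_form {V : Type u} [AddCommGroup V] [Module ℂ V]
    (B : V →ₗ⋆[ℂ] V →ₗ[ℂ] ℂ) (hsymm : ∀ v w, star (B w v) = B v w) (hpos : ∀ v, 0 ≤ B v v) :
    ∃ (K : Type u) (_ : NormedAddCommGroup K) (_ : InnerProductSpace ℂ K) (_ : CompleteSpace K)
      (ι : V →ₗ[ℂ] K), DenseRange ι ∧ ∀ v w, ⟪ι v, ι w⟫_ℂ = B v w := by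
  let core : PreInnerProductSpace.Core ℂ V :=
    { inner := fun v w => B v w
      conj_inner_symm := hsymm
      re_inner_nonneg := fun v => (RCLike.nonneg_iff.mp (hpos v)).1
      add_left := fun x y z => by simp
      smul_left := fun x y r => by simp }
  let _ : SeminormedAddCommGroup V :=
    InnerProductSpace.Core.toSeminormedAddCommGroup (c := core)
  let _ : InnerProductSpace ℂ V := InnerProductSpace.ofCore core
  refine ⟨UniformSpace.Completion V, inferInstance, inferInstance, inferInstance,
    (UniformSpace.Completion.toComplL (𝕜 := ℂ) (E := V)).toLinearMap,
    UniformSpace.Completion.denseRange_coe, fun v w => ?_⟩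
  exact UniformSpace.Completion.inner_coe v w

section Dense

variable {V : Type u} [AddCommGroup V] [Module ℂ V] {K : Type v} [NormedAddCommGroup K]
  [InnerProductSpace ℂ K] [CompleteSpace K] {ι : V →ₗ[ℂ] K}

theorem exists_operator_of_form (hι : DenseRange ι) (F : V →ₗ⋆[ℂ] V →ₗ[ℂ] ℂ) (C : ℝ)
    (hF : ∀ v w, ‖F v w‖ ≤ C * ‖ι v‖ * ‖ι w‖) :
    ∃ T : K →L[ℂ] K, ∀ v w, ⟪ι v, T (ι w)⟫_ℂ = F v w := by
  let _ : SeminormedAddCommGroup V := SeminormedAddCommGroup.induced V K ι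
  let _ : NormedSpace ℂ V := NormedSpace.induced ℂ V K ι
  have hind : IsUniformInducing ι := ⟨rfl⟩
  let F₁ : V →L⋆[ℂ] V →L[ℂ] ℂ := F.mkContinuous₂ C hF
  let j : V →L[ℂ] K := ⟨ι, hind.uniformContinuous.continuous⟩
  let F₂ : K →L[ℂ] V →L⋆[ℂ] ℂ := F₁.flip.extend j
  let F₃ : K →L⋆[ℂ] K →L[ℂ] ℂ := F₂.flip.extend j
  refine ⟨ContinuousLinearMap.adjoint (InnerProductSpace.continuousLinearMapOfBilin F₃),
    fun v w => ?_⟩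
  rw [ContinuousLinearMap.adjoint_inner_right, InnerProductSpace.continuousLinearMapOfBilin_apply]
  have h3 : F₃ (ι v) = F₂.flip v := F₂.flip.extend_eq (e := j) hι hind v
  have h2 : F₂ (ι w) = F₁.flip w := F₁.flip.extend_eq (e := j) hι hind w
  rw [h3, ContinuousLinearMap.flip_apply, h2]
  rfl

omit [CompleteSpace K] in
theorem eq_of_inner_dense (hι : DenseRange ι) {k l : K} (h : ∀ v, ⟪ι v, k⟫_ℂ = ⟪ι v, l⟫_ℂ) :
    k = l := by
  refine ext_inner_left ℂ fun x => ?_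
  exact hι.induction_on (p := fun x => ⟪x, k⟫_ℂ = ⟪x, l⟫_ℂ) x
    (isClosed_eq (by fun_prop) (by fun_prop)) h

omit [CompleteSpace K] in
theorem operator_eq_of_inner_dense (hι : DenseRange ι) {T T' : K →L[ℂ] K}
    (h : ∀ v w, ⟪ι v, T (ι w)⟫_ℂ = ⟪ι v, T' (ι w)⟫_ℂ) : T = T' :=
  ContinuousLinearMap.coeFn_injective <| hι.equalizer T.continuous T'.continuous <|
    funext fun w => eq_of_inner_dense hι fun v => h v w

end Dense

/-- A quantity `a` invariant under `(x, y) ↦ (t x, t⁻¹ y)`, such as the modulus of a sesquilinear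
form, is bounded by `r x y` as soon as it is bounded by `r (x² + y²) / 2`: optimise over `t`. -/
theorem le_mul_of_forall_scaling {a r x y : ℝ} (hx : 0 ≤ x) (hy : 0 ≤ y) (hr : 0 ≤ r)
    (h : ∀ t : ℝ, 0 < t → 2 * a ≤ r * ((t * x) ^ 2 + (t⁻¹ * y) ^ 2)) : a ≤ r * x * y := by
  -- `x` and `y` may vanish; the shift by `ε` makes the optimal `t` available
  have key : ∀ ε : ℝ, 0 < ε → a ≤ r * (x + ε) * (y + ε) := by
    intro ε hε
    have hx' : 0 < x + ε := by positivity
    have hy' : 0 < y + ε := by positivity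
    have ht := h (Real.sqrt ((y + ε) / (x + ε))) (Real.sqrt_pos.2 (by positivity))
    rw [mul_pow, mul_pow, inv_pow, Real.sq_sqrt (by positivity), inv_div] at ht
    have h1 : (y + ε) / (x + ε) * x ^ 2 ≤ (x + ε) * (y + ε) := by
      calc (y + ε) / (x + ε) * x ^ 2 ≤ (y + ε) / (x + ε) * (x + ε) ^ 2 := by
            gcongr; linarith
        _ = (x + ε) * (y + ε) := by field_simp
    have h2 : (x + ε) / (y + ε) * y ^ 2 ≤ (x + ε) * (y + ε) := by
      calc (x + ε) / (y + ε) * y ^ 2 ≤ (x + ε) / (y + ε) * (y + ε) ^ 2 := by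
            gcongr; linarith
        _ = (x + ε) * (y + ε) := by field_simp
    have := mul_le_mul_of_nonneg_left (add_le_add h1 h2) hr
    linarith
  have lim : Filter.Tendsto (fun ε : ℝ => r * (x + ε) * (y + ε)) (nhdsWithin 0 (Set.Ioi 0))
      (nhds (r * x * y)) := by
    have : Continuous fun ε : ℝ => r * (x + ε) * (y + ε) := by fun_prop
    simpa using (this.tendsto 0).mono_left nhdsWithin_le_nhds
  exact ge_of_tendsto lim (Filter.eventually_of_mem self_mem_nhdsWithin key)

/-! ### The Gelfand–Naimark–Segal construction for operator systems -/

section Systems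

variable {S : Type*} [AddCommGroup S] [Module ℂ S] [StarAddMonoid S] [StarModule ℂ S]
  [OperatorSystem S]

theorem diagonal_unit_mem_cone (n : ℕ) :
    Matrix.diagonal (fun _ : Fin n => (OperatorSystem.unit : S)) ∈ MatrixCone.cone n := by
  obtain ⟨r, hr, h⟩ := OperatorSystem.order_unit (S := S) (n := n) (x := 0) (by simp)
  have := OperatorSystem.cone_smul (inv_nonneg.2 hr.le) h
  rw [add_zero, smul_smul, ← Complex.ofReal_mul, inv_mul_cancel₀ hr.ne'] at this
  simpa using this

variable {V : Type u} [AddCommGroup V] [Module ℂ V]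

/-- What positivity of `F` on `M₂(S)⁺` says when it is applied to `[[r e, s], [s*, r e]]`: the family
is hermitian, and `F s` is dominated by `F e`. -/
theorem two_positivity (F : S →ₗ[ℂ] V →ₗ⋆[ℂ] V →ₗ[ℂ] ℂ)
    (hF : ∀ (m : ℕ) (s : Matrix (Fin m) (Fin m) S), s ∈ MatrixCone.cone m → ∀ v : Fin m → V,
      0 ≤ ∑ p, ∑ q, F (s p q) (v p) (v q)) (s : S) :
    (∀ v w, F (star s) w v = star (F s v w)) ∧ ∃ r : ℝ, 0 < r ∧ ∀ v w,
      -(2 * (F s v w).re) ≤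
        r * ((F OperatorSystem.unit v v).re + (F OperatorSystem.unit w w).re) := by
  obtain ⟨r, hr, h⟩ := OperatorSystem.order_unit (S := S) (n := 2) (x := !![0, s; star s, 0])
    (by ext i j; fin_cases i <;> fin_cases j <;> simp [Matrix.conjTranspose])
  have hpos : ∀ v w, 0 ≤ (r : ℂ) * F OperatorSystem.unit v v + F s v w + (F (star s) w v +
      (r : ℂ) * F OperatorSystem.unit w w) := by
    intro v w
    simpa [Fin.sum_univ_two, Matrix.diagonal] using hF 2 _ h ![v, w]
  have hunit : ∀ v, 0 ≤ F OperatorSystem.unit v v := by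
    intro v
    simpa [Matrix.diagonal] using hF 1 _ (diagonal_unit_mem_cone 1) ![v]
  have hstar : ∀ v w, F (star s) w v = star (F s v w) := by
    intro v w
    have h1 := (Complex.le_def.1 (hpos v w)).2
    -- `w` and `i w` give the imaginary and the real part of the identity
    have h2 := (Complex.le_def.1 (hpos v (Complex.I • w))).2
    have h3 := (Complex.le_def.1 (hunit v)).2
    have h4 := (Complex.le_def.1 (hunit w)).2
    simp at h1 h2 h3 h4
    apply Complex.ext
    · simp
      simp [← h3, ← h4] at h2
      linarith
    · simp
      simp [← h3, ← h4] at h1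
      linarith
  refine ⟨hstar, r, hr, fun v w => ?_⟩
  have h1 := (Complex.le_def.1 (hpos v w)).1
  rw [hstar] at h1
  simp at h1
  linarith

/-- The Gelfand–Naimark–Segal construction for operator systems: a family of sesquilinear forms
`F s` on `V`, linear in `s ∈ S` and completely positive, comes from a unital completely positive map
on the Hilbert space completion of `V` with respect to `F e`. -/
theorem exists_ucp_of_form (F : S →ₗ[ℂ] V →ₗ⋆[ℂ] V →ₗ[ℂ] ℂ)
    (hF : ∀ (m : ℕ) (s : Matrix (Fin m) (Fin m) S), s ∈ MatrixCone.cone m → ∀ v : Fin m → V,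
      0 ≤ ∑ p, ∑ q, F (s p q) (v p) (v q)) :
    ∃ (K : Type u) (_ : NormedAddCommGroup K) (_ : InnerProductSpace ℂ K) (_ : CompleteSpace K)
      (ι : V →ₗ[ℂ] K) (ψ : S →ₗ[ℂ] (K →L[ℂ] K)), DenseRange ι ∧ IsUCP ψ ∧
      ∀ s v w, ⟪ι v, ψ s (ι w)⟫_ℂ = F s v w := by
  have hsymm : ∀ v w, star (F OperatorSystem.unit w v) = F OperatorSystem.unit v w := by
    intro v w
    rw [← (two_positivity F hF _).1, OperatorSystem.star_unit]
  have hpos : ∀ v, 0 ≤ F OperatorSystem.unit v v := by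
    intro v
    simpa [Matrix.diagonal] using hF 1 _ (diagonal_unit_mem_cone 1) ![v]
  obtain ⟨K, _, _, _, ι, hι, hinner⟩ := exists_hilbert_of_form (F OperatorSystem.unit) hsymm hpos
  have hnorm : ∀ v, (F OperatorSystem.unit v v).re = ‖ι v‖ ^ 2 := by
    intro v
    rw [← hinner, inner_self_eq_norm_sq_to_K]
    simp [← Complex.ofReal_pow]
  have hop : ∀ s, ∃ T : K →L[ℂ] K, ∀ v w, ⟪ι v, T (ι w)⟫_ℂ = F s v w := by
    intro s
    obtain ⟨-, r, hr, hb⟩ := two_positivity F hF s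
    refine exists_operator_of_form hι (F s) r fun v w => ?_
    refine le_mul_of_forall_scaling (norm_nonneg _) (norm_nonneg _) hr.le fun t ht => ?_
    -- the unimodular factor `c` turns the value of the form into minus its modulus
    obtain ⟨c, hc, hcF⟩ : ∃ c : ℂ, ‖c‖ = 1 ∧ c * F s v w = -(‖F s v w‖ : ℂ) := by
      obtain ⟨c, hc, hcF⟩ := RCLike.exists_norm_eq_mul_self (F s v w)
      exact ⟨-c, by simpa using hc, by simpa using congrArg Neg.neg hcF.symm⟩
    have := hb ((t : ℂ) • v) ((c * (t : ℂ)⁻¹) • w)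
    have ht' : (t : ℂ) ≠ 0 := by exact_mod_cast ht.ne'
    have hval : F s ((t : ℂ) • v) ((c * (t : ℂ)⁻¹) • w) = -(‖F s v w‖ : ℂ) := by
      rw [map_smul, map_smulₛₗ, LinearMap.smul_apply, smul_eq_mul, smul_eq_mul,
        Complex.conj_ofReal, ← hcF]
      field_simp
    rw [hval, hnorm, hnorm, map_smul, map_smul, norm_smul, norm_smul, norm_mul, hc] at this
    simpa [abs_of_pos ht] using this
  choose T hT using hop
  let ψ : S →ₗ[ℂ] (K →L[ℂ] K) :=
    { toFun := T
      map_add' := fun s s' => operator_eq_of_inner_dense hι fun v w => by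
        simp [hT]
      map_smul' := fun c s => operator_eq_of_inner_dense hι fun v w => by
        simp [hT] }
  have hψ : ∀ s v w, ⟪ι v, ψ s (ι w)⟫_ℂ = F s v w := hT
  refine ⟨K, inferInstance, inferInstance, inferInstance, ι, ψ, hι, ⟨⟨fun s => ?_, ?_⟩, ?_⟩, hψ⟩
  · refine operator_eq_of_inner_dense hι fun v w => ?_
    rw [ContinuousLinearMap.star_eq_adjoint, ContinuousLinearMap.adjoint_inner_right, hψ,
      ← inner_conj_symm, hψ, (two_positivity F hF s).1]
    rfl
  · intro m s hs
    change (toOp (s.map ψ)).IsPositive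
    rw [ContinuousLinearMap.isPositive_iff_complex]
    have key : ∀ k : Fin m → K, 0 ≤ ∑ p, ∑ q, ⟪ψ (s p q) (k q), k p⟫_ℂ := by
      intro k
      have hd : DenseRange (Pi.map fun _ : Fin m => (ι : V → K)) := DenseRange.piMap fun _ => hι
      refine hd.induction_on (p := fun k => 0 ≤ ∑ p, ∑ q, ⟪ψ (s p q) (k q), k p⟫_ℂ) k
        (isClosed_le continuous_const ?_) fun v => ?_
      · fun_prop
      · have := hF m s hs v
        rw [← star_nonneg_iff] at this
        simpa [← hψ] using this
    intro k
    have hk : ⟪toOp (s.map ψ) k, k⟫_ℂ = ∑ p, ∑ q, ⟪ψ (s p q) (k q), k p⟫_ℂ := by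
      simp [PiLp.inner_apply, toOp_apply, sum_inner]
    have h0 := key (fun i => k i)
    rw [← hk, Complex.le_def] at h0
    exact ⟨Complex.ext (by simp) (by simpa using h0.2), h0.1⟩
  · refine operator_eq_of_inner_dense hι fun v w => ?_
    rw [hψ, ← hinner]
    rfl

end Systems

/-! ### Block matrices and amplifications -/

section Blocks

variable {X Y : Type*} {n m : ℕ} (a : Matrix (Fin n) (Fin n) X) (b : Matrix (Fin n) (Fin m) X)
  (c : Matrix (Fin m) (Fin n) X) (d : Matrix (Fin m) (Fin m) X)

theorem blockMat_castAdd_castAdd (i j : Fin n) :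
    blockMat a b c d (Fin.castAdd m i) (Fin.castAdd m j) = a i j := by
  simp [blockMat]

theorem blockMat_castAdd_natAdd (i : Fin n) (j : Fin m) :
    blockMat a b c d (Fin.castAdd m i) (Fin.natAdd n j) = b i j := by
  simp [blockMat]

theorem blockMat_natAdd_castAdd (i : Fin m) (j : Fin n) :
    blockMat a b c d (Fin.natAdd n i) (Fin.castAdd m j) = c i j := by
  simp [blockMat]

theorem blockMat_natAdd_natAdd (i j : Fin m) :
    blockMat a b c d (Fin.natAdd n i) (Fin.natAdd n j) = d i j := by
  simp [blockMat]

variable {a b c d} in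
theorem eq_blockMat {x : Matrix (Fin (n + m)) (Fin (n + m)) X}
    (ha : ∀ i j, x (Fin.castAdd m i) (Fin.castAdd m j) = a i j)
    (hb : ∀ i j, x (Fin.castAdd m i) (Fin.natAdd n j) = b i j)
    (hc : ∀ i j, x (Fin.natAdd n i) (Fin.castAdd m j) = c i j)
    (hd : ∀ i j, x (Fin.natAdd n i) (Fin.natAdd n j) = d i j) : x = blockMat a b c d := by
  ext1 i j
  refine Fin.addCases (fun i => ?_) (fun i => ?_) i <;>
    refine Fin.addCases (fun j => ?_) (fun j => ?_) j
  · rw [ha, blockMat_castAdd_castAdd]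
  · rw [hb, blockMat_castAdd_natAdd]
  · rw [hc, blockMat_natAdd_castAdd]
  · rw [hd, blockMat_natAdd_natAdd]

theorem blockMat_map (f : X → Y) :
    (blockMat a b c d).map f = blockMat (a.map f) (b.map f) (c.map f) (d.map f) := by
  apply eq_blockMat <;> simp [blockMat]

theorem blockMat_conjTranspose [Star X] : (blockMat a b c d).conjTranspose =
    blockMat a.conjTranspose c.conjTranspose b.conjTranspose d.conjTranspose := by
  apply eq_blockMat <;> simp [blockMat]

theorem diagonal_add_blockMat [AddMonoid X] (u : X) :
    (Matrix.diagonal fun _ => u) + blockMat 0 b c 0 =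
      blockMat (Matrix.diagonal fun _ => u) b c (Matrix.diagonal fun _ => u) := by
  have h : ∀ (i : Fin n) (j : Fin m), Fin.castAdd m i ≠ Fin.natAdd n j := fun i j h =>
    absurd (congrArg Fin.val h) (by simp; omega)
  apply eq_blockMat <;> simp [blockMat, Matrix.diagonal_apply, h, (h _ _).symm]

end Blocks

section Amplifications

variable {H K L : Type*} [NormedAddCommGroup H] [InnerProductSpace ℂ H]
  [NormedAddCommGroup K] [InnerProductSpace ℂ K] [NormedAddCommGroup L] [InnerProductSpace ℂ L]

theorem toOp_sum_comp {l m n : ℕ} (T : Matrix (Fin l) (Fin m) (K →L[ℂ] L))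
    (R : Matrix (Fin m) (Fin n) (H →L[ℂ] K)) :
    toOp (Matrix.of fun i j => ∑ p, T i p ∘L R p j) = toOp T ∘L toOp R := by
  ext ξ i
  simp only [toOp_apply, ContinuousLinearMap.comp_apply, Matrix.of_apply,
    sum_apply, map_sum]
  exact Finset.sum_comm

theorem adjoint_toOp [CompleteSpace H] [CompleteSpace K] {m n : ℕ}
    (T : Matrix (Fin m) (Fin n) (H →L[ℂ] K)) :
    ContinuousLinearMap.adjoint (toOp T) =
      toOp (Matrix.of fun i j => ContinuousLinearMap.adjoint (T j i)) := by
  symm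
  rw [ContinuousLinearMap.eq_adjoint_iff]
  intro x y
  simp only [PiLp.inner_apply, toOp_apply, sum_inner, inner_sum, Matrix.of_apply,
    ContinuousLinearMap.adjoint_inner_left]
  exact Finset.sum_comm

/-- If `[[r, T], [T*, r]]` is positive then `‖T‖ ≤ r`. -/
theorem norm_toOp_le_of_block [CompleteSpace K] {n : ℕ} {T : Matrix (Fin n) (Fin n) (K →L[ℂ] K)}
    {r : ℝ} (hr : 0 ≤ r)
    (h : (toOp (blockMat ((r : ℂ) • Matrix.diagonal fun _ => (1 : K →L[ℂ] K)) T T.conjTranspose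
      ((r : ℂ) • Matrix.diagonal fun _ => (1 : K →L[ℂ] K)))).IsPositive) :
    ‖toOp T‖ ≤ r := by
  have hquad : ∀ η ξ : PiLp 2 fun _ : Fin n => K,
      0 ≤ r * ‖η‖ ^ 2 + r * ‖ξ‖ ^ 2 + 2 * (⟪η, toOp T ξ⟫_ℂ).re := by
    intro η ξ
    have h0 := h.re_inner_nonneg_right
      (WithLp.toLp 2 (Fin.append (fun i => η i) fun i => ξ i) : PiLp 2 fun _ : Fin (n + n) => K)
    have hdiag : ∀ (ζ : PiLp 2 fun _ : Fin n => K) (i : Fin n),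
        ∑ j, ((r : ℂ) • Matrix.diagonal fun _ : Fin n => (1 : K →L[ℂ] K)) i j (ζ j) =
          (r : ℂ) • ζ i := by
      intro ζ i
      rw [Finset.sum_eq_single i]
      · simp
      · intro j _ hj
        rw [Matrix.smul_apply, Matrix.diagonal_apply_ne _ hj.symm, smul_zero,
          zero_apply]
      · simp
    have hstar : ∑ i, ⟪ξ i, ∑ j, T.conjTranspose i j (η j)⟫_ℂ = ⟪toOp T ξ, η⟫_ℂ := by
      simp only [PiLp.inner_apply, toOp_apply, sum_inner, inner_sum, Matrix.conjTranspose_apply,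
        ContinuousLinearMap.star_eq_adjoint, ContinuousLinearMap.adjoint_inner_right]
      exact Finset.sum_comm
    have hsq : ∀ ζ : PiLp 2 fun _ : Fin n => K, ∑ i, ⟪ζ i, ζ i⟫_ℂ = (‖ζ‖ ^ 2 : ℝ) := by
      intro ζ
      rw [← PiLp.inner_apply, inner_self_eq_norm_sq_to_K]
      simp
    have hT : ∑ i, ⟪η i, ∑ j, T i j (ξ j)⟫_ℂ = ⟪η, toOp T ξ⟫_ℂ := by
      simp only [PiLp.inner_apply, toOp_apply]
    have hval : ⟪(WithLp.toLp 2 (Fin.append (fun i => η i) fun i => ξ i) :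
        PiLp 2 fun _ : Fin (n + n) => K), toOp (blockMat
          ((r : ℂ) • Matrix.diagonal fun _ => (1 : K →L[ℂ] K)) T T.conjTranspose
          ((r : ℂ) • Matrix.diagonal fun _ => (1 : K →L[ℂ] K)))
        (WithLp.toLp 2 (Fin.append (fun i => η i) fun i => ξ i))⟫_ℂ =
        (r : ℂ) * (‖η‖ ^ 2 : ℝ) + ⟪η, toOp T ξ⟫_ℂ +
          (⟪toOp T ξ, η⟫_ℂ + (r : ℂ) * (‖ξ‖ ^ 2 : ℝ)) := by
      rw [← hstar, ← hT, ← hsq, ← hsq, Finset.mul_sum, Finset.mul_sum, ← Finset.sum_add_distrib,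
        ← Finset.sum_add_distrib, PiLp.inner_apply, Fin.sum_univ_add]
      congr 1
      · refine Finset.sum_congr rfl fun i _ => ?_
        simp only [toOp_apply, Fin.sum_univ_add, inner_add_right, ← inner_smul_right, ← hdiag,
          blockMat_castAdd_castAdd, blockMat_castAdd_natAdd, Fin.append_left, Fin.append_right]
      · refine Finset.sum_congr rfl fun i _ => ?_
        simp only [toOp_apply, Fin.sum_univ_add, inner_add_right, ← inner_smul_right, ← hdiag,
          blockMat_natAdd_castAdd, blockMat_natAdd_natAdd, Fin.append_left, Fin.append_right]
    rw [hval] at h0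
    have hre : (⟪toOp T ξ, η⟫_ℂ).re = (⟪η, toOp T ξ⟫_ℂ).re := inner_re_symm (𝕜 := ℂ) _ _
    simp [-Complex.ofReal_pow, hre] at h0
    linarith
  refine ContinuousLinearMap.opNorm_le_bound _ hr fun ξ => ?_
  have hsq : ‖toOp T ξ‖ * ‖toOp T ξ‖ ≤ r * ‖toOp T ξ‖ * ‖ξ‖ := by
    refine le_mul_of_forall_scaling (norm_nonneg _) (norm_nonneg _) hr fun t ht => ?_
    have h0 := hquad (-((t : ℂ) • toOp T ξ)) ((t : ℂ)⁻¹ • ξ)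
    have ht' : (t : ℂ) ≠ 0 := by exact_mod_cast ht.ne'
    rw [map_smul, inner_neg_left, inner_smul_left, inner_smul_right, Complex.conj_ofReal,
      mul_inv_cancel_left₀ ht', inner_self_eq_norm_sq_to_K, norm_neg, norm_smul, norm_smul] at h0
    simp [abs_of_pos ht, ← Complex.ofReal_pow] at h0
    linarith
  rcases (norm_nonneg (toOp T ξ)).eq_or_lt with h0 | h0
  · rw [← h0]
    positivity
  · refine le_of_mul_le_mul_right ?_ h0
    linarith

end Amplifications

/-! ### Complete contractivity of unital completely positive maps -/

section Systems

variable {S : Type*} [AddCommGroup S] [Module ℂ S] [StarAddMonoid S] [StarModule ℂ S]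
  [OperatorSystem S]

theorem mnorm_def {n : ℕ} (x : Matrix (Fin n) (Fin n) S) :
    MatrixNorm.mnorm x = sInf {r : ℝ | 0 ≤ r ∧
    blockMat ((r : ℂ) • Matrix.diagonal fun _ : Fin n => (OperatorSystem.unit : S)) x
      x.conjTranspose ((r : ℂ) • Matrix.diagonal fun _ : Fin n => (OperatorSystem.unit : S)) ∈
      MatrixCone.cone (n + n)} := rfl

theorem mnorm_nonneg_of_system {n : ℕ} (x : Matrix (Fin n) (Fin n) S) :
    0 ≤ MatrixNorm.mnorm x :=
  Real.sInf_nonneg fun _ hr => hr.1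

theorem mnorm_diagonal_unit_le (n : ℕ) :
    MatrixNorm.mnorm (Matrix.diagonal fun _ : Fin n => (OperatorSystem.unit : S)) ≤ 1 := by
  refine csInf_le ⟨0, fun _ hr => hr.1⟩ ⟨zero_le_one, ?_⟩
  -- the block matrix is the compression of the unit by the row `[1 1]`
  let α : Matrix (Fin n) (Fin (n + n)) ℂ :=
    Matrix.of fun p i => Fin.addCases (fun i => if p = i then 1 else 0)
      (fun i => if p = i then 1 else 0) i
  convert OperatorSystem.cone_compatible α (diagonal_unit_mem_cone (S := S) n) using 1
  symm
  apply eq_blockMat <;> intro i j <;>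
    simp only [scalarMul, α, Matrix.conjTranspose_apply, Matrix.of_apply, Fin.addCases_left,
      Fin.addCases_right] <;>
    rcases eq_or_ne i j with rfl | hij
  all_goals first
    | simp [apply_ite, hij, hij.symm]
    | simp [Matrix.diagonal_apply, OperatorSystem.star_unit, apply_ite]

variable {K : Type*} [NormedAddCommGroup K] [InnerProductSpace ℂ K] [CompleteSpace K]

/-- Unital completely positive maps are completely contractive. -/
theorem IsUCP.norm_toOp_map_le {ψ : S →ₗ[ℂ] (K →L[ℂ] K)} (hψ : IsUCP ψ) {n : ℕ}
    (s : Matrix (Fin n) (Fin n) S) : ‖toOp (s.map ψ)‖ ≤ MatrixNorm.mnorm s := by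
  rw [mnorm_def]
  refine le_csInf ?_ ?_
  · obtain ⟨r, hr, h⟩ := OperatorSystem.order_unit (x := blockMat 0 s s.conjTranspose 0) (by
      simp [blockMat_conjTranspose])
    refine ⟨r, hr.le, ?_⟩
    rwa [← Matrix.diagonal_smul, Pi.smul_def, diagonal_add_blockMat, ← Pi.smul_def,
      Matrix.diagonal_smul] at h
  · rintro r ⟨hr, h⟩
    refine norm_toOp_le_of_block hr ?_
    have h1 := hψ.1.2 _ _ h
    rw [blockMat_map] at h1
    have hd : (((r : ℂ) • Matrix.diagonal fun _ : Fin n => (OperatorSystem.unit : S)).map ψ) =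
        (r : ℂ) • Matrix.diagonal fun _ => (1 : K →L[ℂ] K) := by
      ext1 i j
      by_cases hij : i = j
      · simp [hij, hψ.2]
      · simp [hij]
    have hs : s.conjTranspose.map ψ = (s.map ψ).conjTranspose := by
      ext1 i j
      simp [hψ.1.1]
    rw [hd, hs] at h1
    exact h1

end Systems

/-! ### Completely bounded norms -/

section Norms

theorem mnorm_nonneg {X : Type*} [AddCommGroup X] [Module ℂ X] [OperatorSpace X] {n : ℕ}
    (x : Matrix (Fin n) (Fin n) X) : 0 ≤ MatrixNorm.mnorm x := by
  have h0 : MatrixNorm.mnorm (0 : Matrix (Fin n) (Fin n) X) = 0 := by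
    simpa using OperatorSpace.mnorm_smul 0 (0 : Matrix (Fin n) (Fin n) X)
  have h1 := OperatorSpace.mnorm_add_le x ((-1 : ℂ) • x)
  rw [OperatorSpace.mnorm_smul] at h1
  simp [h0] at h1
  exact h1

/-- The infimum of all bounds `c` for `f` relative to `g` is itself a bound. -/
theorem iInf_coe_le_iff {ι : Type*} {f g : ι → ℝ} (hg : ∀ i, 0 ≤ g i) (C : ℝ≥0) :
    (⨅ (c : ℝ≥0) (_ : ∀ i, f i ≤ c * g i), (c : ℝ≥0∞)) ≤ C ↔ ∀ i, f i ≤ C * g i := by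
  constructor
  · intro h i
    have key : ∀ ε : ℝ≥0, 0 < ε → f i ≤ (C + ε : ℝ≥0) * g i := by
      intro ε hε
      have hlt := h.trans_lt (ENNReal.coe_lt_coe.2 (lt_add_of_pos_right C hε))
      simp only [iInf_lt_iff] at hlt
      obtain ⟨c, hc, hcC⟩ := hlt
      refine (hc i).trans (mul_le_mul_of_nonneg_right ?_ (hg i))
      exact_mod_cast hcC.le
    have lim : Filter.Tendsto (fun ε : ℝ≥0 => ((C + ε : ℝ≥0) : ℝ) * g i)
        (nhdsWithin 0 (Set.Ioi 0)) (nhds (C * g i)) := by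
      have : Continuous fun ε : ℝ≥0 => ((C + ε : ℝ≥0) : ℝ) * g i := by fun_prop
      simpa using (this.tendsto 0).mono_left nhdsWithin_le_nhds
    exact ge_of_tendsto lim (Filter.eventually_of_mem self_mem_nhdsWithin key)
  · exact fun h => iInf₂_le C h

theorem cbNorm_le_iff {X Y : Type*} [AddCommGroup X] [Module ℂ X] [AddCommGroup Y] [Module ℂ Y]
    [OperatorSpace X] [MatrixNorm Y] {φ : X →ₗ[ℂ] Y} {C : ℝ≥0} :
    cbNorm φ ≤ C ↔ ∀ (n : ℕ) (x : Matrix (Fin n) (Fin n) X),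
      MatrixNorm.mnorm (x.map φ) ≤ C * MatrixNorm.mnorm x := by
  rw [cbNorm, iSup_le_iff]
  exact forall_congr' fun n => iInf_coe_le_iff (fun x => mnorm_nonneg x) C

variable {E S : Type*} [AddCommGroup E] [Module ℂ E] [OperatorSpace E]
  [AddCommGroup S] [Module ℂ S] [StarAddMonoid S] [StarModule ℂ S] [OperatorSystem S]
  {H K : Type*} [NormedAddCommGroup H] [InnerProductSpace ℂ H] [CompleteSpace H]
  [NormedAddCommGroup K] [InnerProductSpace ℂ K] [CompleteSpace K]

theorem mnorm_matAdj {n : ℕ} (x : Matrix (Fin n) (Fin n) E) :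
    MatrixNorm.mnorm (matAdj x) = MatrixNorm.mnorm x := rfl

omit [Module ℂ E] [OperatorSpace E] in
theorem matAdj_surjective {m n : ℕ} :
    Function.Surjective (matAdj : Matrix (Fin m) (Fin n) E → _) := fun y =>
  ⟨Matrix.of fun i j => adj.symm (y j i), rfl⟩

theorem triCBNorm_le_iff {T : Type*} [AddCommGroup T] [Module ℂ T] [MatrixNorm T]
    {θ : AdjointSpace E →ₗ[ℂ] S →ₗ[ℂ] E →ₗ[ℂ] T} {C : ℝ≥0} :
    triCBNorm θ ≤ C ↔ ∀ (n : ℕ) (y : Matrix (Fin n) (Fin n) E) (s : Matrix (Fin n) (Fin n) S)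
      (x : Matrix (Fin n) (Fin n) E), MatrixNorm.mnorm (triAmp θ (matAdj y) s x) ≤
        C * (MatrixNorm.mnorm y * MatrixNorm.mnorm s * MatrixNorm.mnorm x) := by
  rw [triCBNorm, iSup_le_iff]
  refine forall_congr' fun n => ?_
  have := iInf_coe_le_iff (ι := Matrix (Fin n) (Fin n) (AdjointSpace E) ×
    Matrix (Fin n) (Fin n) S × Matrix (Fin n) (Fin n) E)
    (f := fun i => MatrixNorm.mnorm (triAmp θ i.1 i.2.1 i.2.2))
    (g := fun i => MatrixNorm.mnorm i.1 * MatrixNorm.mnorm i.2.1 * MatrixNorm.mnorm i.2.2)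
    (fun i => by
      obtain ⟨y, hy⟩ := matAdj_surjective i.1
      rw [← hy, mnorm_matAdj]
      exact mul_nonneg (mul_nonneg (mnorm_nonneg _) (mnorm_nonneg_of_system _)) (mnorm_nonneg _)) C
  simp only [← mul_assoc, Prod.forall] at this
  rw [triLevelNorm, this]
  simp only [matAdj_surjective.forall, mnorm_matAdj, mul_assoc]

omit [OperatorSpace E] [StarAddMonoid S] [StarModule ℂ S] [OperatorSystem S] in
theorem FactorsAs.toOp_triAmp {θ : AdjointSpace E →ₗ[ℂ] S →ₗ[ℂ] E →ₗ[ℂ] (H →L[ℂ] H)}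
    {φ : E →ₗ[ℂ] (H →L[ℂ] K)} {ψ : S →ₗ[ℂ] (K →L[ℂ] K)} (h : FactorsAs θ φ ψ) {m n : ℕ}
    (y : Matrix (Fin m) (Fin n) E) (s : Matrix (Fin m) (Fin m) S) (x : Matrix (Fin m) (Fin n) E) :
    toOp (triAmp θ (matAdj y) s x) =
      ContinuousLinearMap.adjoint (toOp (y.map φ)) ∘L toOp (s.map ψ) ∘L toOp (x.map φ) := by
  rw [← toOp_sum_comp, adjoint_toOp, ← toOp_sum_comp]
  congr 1
  ext1 i j
  simp only [triAmp, matAdj, Matrix.of_apply, Matrix.map_apply, h _ _ _]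
  refine Finset.sum_congr rfl fun p _ => ?_
  exact (ContinuousLinearMap.comp_finsetSum (ContinuousLinearMap.adjoint (φ (y p i))) _).symm

/-- A factorisation `θ = φ* · ψ · φ` through a unital completely positive map `ψ` automatically has
`‖θ‖_cb = ‖φ‖_cb²`: `≤` holds because `ψ` is completely contractive, and `≥` because
`φ(x)* φ(x) = θ(x*, e ⊗ I_n, x)`. -/
theorem FactorsAs.isCB_and_norm_eq {θ : AdjointSpace E →ₗ[ℂ] S →ₗ[ℂ] E →ₗ[ℂ] (H →L[ℂ] H)}
    {φ : E →ₗ[ℂ] (H →L[ℂ] K)} {ψ : S →ₗ[ℂ] (K →L[ℂ] K)} (h : FactorsAs θ φ ψ) (hψ : IsUCP ψ)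
    (hθ : IsTriCB θ) : IsCB φ ∧ triCBNorm θ = cbNorm φ ^ 2 := by
  have hle : cbNorm φ ≤ (NNReal.sqrt (triCBNorm θ).toNNReal : ℝ≥0) := by
    rw [cbNorm_le_iff]
    intro n x
    have hC := triCBNorm_le_iff.1 (ENNReal.coe_toNNReal hθ.ne).ge n x
      (Matrix.diagonal fun _ => OperatorSystem.unit) x
    change ‖toOp _‖ ≤ _ at hC
    have hone : toOp ((Matrix.diagonal fun _ : Fin n => (OperatorSystem.unit : S)).map ψ) =
        ContinuousLinearMap.id ℂ _ := by
      ext ξ i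
      rw [toOp_apply, Finset.sum_eq_single i]
      · simp [hψ.2]
      · intro j _ hj
        simp [Matrix.diagonal_apply_ne _ hj.symm]
      · simp
    rw [h.toOp_triAmp, hone, ContinuousLinearMap.id_comp,
      ContinuousLinearMap.norm_adjoint_comp_self] at hC
    change ‖toOp (x.map φ)‖ ≤ _
    refine abs_le_of_sq_le_sq' ?_ (mul_nonneg (NNReal.coe_nonneg _) (mnorm_nonneg x)) |>.2
    rw [mul_pow, ← NNReal.coe_pow, NNReal.sq_sqrt, sq, sq]
    refine hC.trans (mul_le_mul_of_nonneg_left ?_ (NNReal.coe_nonneg _))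
    exact mul_le_mul_of_nonneg_right
      (mul_le_of_le_one_right (mnorm_nonneg x) (mnorm_diagonal_unit_le n)) (mnorm_nonneg x)
  have hcb : IsCB φ := hle.trans_lt ENNReal.coe_lt_top
  refine ⟨hcb, le_antisymm ?_ ?_⟩
  · rw [← ENNReal.coe_toNNReal hcb.ne, ← ENNReal.coe_pow, triCBNorm_le_iff]
    have hφ := cbNorm_le_iff.1 (ENNReal.coe_toNNReal hcb.ne).ge
    intro n y s x
    change ‖toOp _‖ ≤ _
    rw [h.toOp_triAmp]
    calc _ ≤ ‖ContinuousLinearMap.adjoint (toOp (y.map φ))‖ *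
          (‖toOp (s.map ψ)‖ * ‖toOp (x.map φ)‖) :=
        (ContinuousLinearMap.opNorm_comp_le _ _).trans
          (mul_le_mul_of_nonneg_left (ContinuousLinearMap.opNorm_comp_le _ _) (norm_nonneg _))
      _ ≤ ((cbNorm φ).toNNReal * MatrixNorm.mnorm y) *
          (MatrixNorm.mnorm s * ((cbNorm φ).toNNReal * MatrixNorm.mnorm x)) := by
        rw [LinearIsometryEquiv.norm_map]
        have := mnorm_nonneg_of_system s
        have := mnorm_nonneg y
        exact mul_le_mul (hφ n y) (mul_le_mul (hψ.norm_toOp_map_le s) (hφ n x)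
          (ContinuousLinearMap.opNorm_nonneg _) (mnorm_nonneg_of_system s)) (by positivity)
          (by positivity)
      _ = _ := by
        push_cast
        ring
  · calc cbNorm φ ^ 2 ≤ (NNReal.sqrt (triCBNorm θ).toNNReal : ℝ≥0∞) ^ 2 := by gcongr
      _ = triCBNorm θ := by
        rw [← ENNReal.coe_pow, NNReal.sq_sqrt, ENNReal.coe_toNNReal hθ.ne]

end Norms

/-! ### Dilation of operator-valued sesquilinear maps -/

section Dilation

/-- Finitely many tensors can be written with the same second legs. -/
theorem exists_common_tensor {X Y : Type*} [AddCommGroup X] [Module ℂ X] [AddCommGroup Y]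
    [Module ℂ Y] {m : ℕ} (v : Fin m → X ⊗[ℂ] Y) :
    ∃ (n : ℕ) (x : Matrix (Fin m) (Fin n) X) (ζ : Fin n → Y), ∀ p, v p = ∑ j, x p j ⊗ₜ ζ j := by
  choose t ht using fun p => TensorProduct.exists_finset (v p)
  let e := Fintype.equivFin (Σ p, t p)
  refine ⟨_, Matrix.of fun p i => if (e.symm i).1 = p then (e.symm i).2.1.1 else 0,
    fun i => (e.symm i).2.1.2, fun p => ?_⟩
  simp only [Matrix.of_apply]
  rw [e.symm.sum_comp (fun i : Σ p, t p => (if i.1 = p then i.2.1.1 else 0) ⊗ₜ[ℂ] i.2.1.2),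
    Fintype.sum_sigma, Finset.sum_eq_single p]
  · rw [ht p, ← Finset.sum_coe_sort]
    simp
  · intro q _ hq
    simp [hq]
  · simp

variable {S : Type*} [AddCommGroup S] [Module ℂ S] [StarAddMonoid S] [StarModule ℂ S]
  [OperatorSystem S] {X : Type u} [AddCommGroup X] [Module ℂ X]
  {Y : Type v} [NormedAddCommGroup Y] [InnerProductSpace ℂ Y]

/-- The scalar forms on `X ⊗ Y` attached to a family of operator-valued sesquilinear maps on `X`,
namely `(y ⊗ η, x ⊗ ξ) ↦ ⟪η, Θ(s)(y, x) ξ⟫`. -/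
def tensorForm (Θ : S →ₗ[ℂ] X →ₗ⋆[ℂ] X →ₗ[ℂ] (Y →L[ℂ] Y)) :
    S →ₗ[ℂ] (X ⊗[ℂ] Y) →ₗ⋆[ℂ] (X ⊗[ℂ] Y) →ₗ[ℂ] ℂ where
  toFun s := TensorProduct.lift <| LinearMap.mk₂'ₛₗ (starRingEnd ℂ) (starRingEnd ℂ)
    (fun y η => innerₛₗ ℂ η ∘ₗ TensorProduct.lift (ContinuousLinearMap.coeLM ℂ ∘ₗ Θ s y))
    (fun y y' η => TensorProduct.ext' fun x ξ => by simp [inner_add_right])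
    (fun c y η => TensorProduct.ext' fun x ξ => by simp [inner_smul_right])
    (fun y η η' => TensorProduct.ext' fun x ξ => by simp)
    (fun c y η => TensorProduct.ext' fun x ξ => by simp)
  map_add' s s' := TensorProduct.ext' fun y η => TensorProduct.ext' fun x ξ => by
    simp [inner_add_right]
  map_smul' c s := TensorProduct.ext' fun y η => TensorProduct.ext' fun x ξ => by
    simp [inner_smul_right]

omit [StarAddMonoid S] [StarModule ℂ S] [OperatorSystem S] in
theorem tensorForm_tmul (Θ : S →ₗ[ℂ] X →ₗ⋆[ℂ] X →ₗ[ℂ] (Y →L[ℂ] Y)) (s : S) (y x : X) (η ξ : Y) :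
    tensorForm Θ s (y ⊗ₜ η) (x ⊗ₜ ξ) = ⟪η, Θ s y x ξ⟫_ℂ := rfl

/-- A completely positive family `Θ s` of operator-valued sesquilinear maps on `X` is of the form
`Θ s (y, x) = V(y)* ψ(s) V(x)` with `ψ` unital completely positive. The last clause expresses
minimality, i.e. that the ranges of the operators `V y` span a dense subspace. -/
theorem exists_dilation [CompleteSpace Y] (Θ : S →ₗ[ℂ] X →ₗ⋆[ℂ] X →ₗ[ℂ] (Y →L[ℂ] Y))
    (hΘ : ∀ (m n : ℕ) (s : Matrix (Fin m) (Fin m) S) (x : Matrix (Fin m) (Fin n) X),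
      s ∈ MatrixCone.cone m →
      Matrix.of (fun i j => ∑ p, ∑ q, Θ (s p q) (x p i) (x q j)) ∈ MatrixCone.cone n) :
    ∃ (K : Type (max u v)) (_ : NormedAddCommGroup K) (_ : InnerProductSpace ℂ K)
      (_ : CompleteSpace K) (V : X →ₗ[ℂ] (Y →L[ℂ] K)) (ψ : S →ₗ[ℂ] (K →L[ℂ] K)), IsUCP ψ ∧
      (∀ s y x, ContinuousLinearMap.adjoint (V y) ∘L ψ s ∘L V x = Θ s y x) ∧
      ∀ k k' : K, (∀ y, ContinuousLinearMap.adjoint (V y) k = ContinuousLinearMap.adjoint (V y) k')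
        → k = k' := by
  have hpos : ∀ (m : ℕ) (s : Matrix (Fin m) (Fin m) S), s ∈ MatrixCone.cone m →
      ∀ v : Fin m → X ⊗[ℂ] Y, 0 ≤ ∑ p, ∑ q, tensorForm Θ (s p q) (v p) (v q) := by
    intro m s hs v
    obtain ⟨n, x, ζ, hv⟩ := exists_common_tensor v
    have h : (toOp (Matrix.of fun i j => ∑ p, ∑ q, Θ (s p q) (x p i) (x q j))).IsPositive :=
      hΘ m n s x hs
    have h0 := h.inner_nonneg_right (WithLp.toLp 2 ζ)
    convert h0 using 1
    simp only [hv, PiLp.inner_apply, toOp_apply, Matrix.of_apply, map_sum, LinearMap.sum_apply,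
      sum_apply, inner_sum, tensorForm_tmul]
    have h1 : ∀ f : Fin m → Fin m → Fin n → Fin n → ℂ, ∑ p, ∑ q, ∑ j, ∑ i, f p q i j =
        ∑ i, ∑ j, ∑ p, ∑ q, f p q i j := by
      intro f
      simp_rw [← Fintype.sum_prod_type']
      exact Fintype.sum_equiv (⟨fun z => (z.2.2.2, z.2.2.1, z.1, z.2.1),
        fun z => (z.2.2.1, z.2.2.2, z.2.1, z.1), fun _ => rfl, fun _ => rfl⟩ :
        Fin m × Fin m × Fin n × Fin n ≃ Fin n × Fin n × Fin m × Fin m) _ _ fun _ => rfl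
    rw [← h1]
  obtain ⟨K, _, _, _, ι, ψ, hι, hψ, hinner⟩ := exists_ucp_of_form (tensorForm Θ) hpos
  have hι_inner : ∀ v w, ⟪ι v, ι w⟫_ℂ = tensorForm Θ OperatorSystem.unit v w := by
    intro v w
    rw [← hinner, hψ.2]
    rfl
  let V : X →ₗ[ℂ] (Y →L[ℂ] K) :=
    { toFun := fun x => (ι ∘ₗ TensorProduct.mk ℂ X Y x).mkContinuous
        (Real.sqrt ‖Θ OperatorSystem.unit x x‖) fun ξ => by
          refine abs_le_of_sq_le_sq' ?_ (by positivity) |>.2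
          rw [mul_pow, Real.sq_sqrt (norm_nonneg _)]
          have h1 : ‖ι (x ⊗ₜ ξ)‖ ^ 2 = ‖⟪ξ, Θ OperatorSystem.unit x x ξ⟫_ℂ‖ := by
            rw [← tensorForm_tmul, ← hι_inner, inner_self_eq_norm_sq_to_K]
            simp
          calc ‖ι (x ⊗ₜ ξ)‖ ^ 2 ≤ ‖ξ‖ * ‖Θ OperatorSystem.unit x x ξ‖ :=
                h1.trans_le (norm_inner_le_norm _ _)
            _ ≤ ‖ξ‖ * (‖Θ OperatorSystem.unit x x‖ * ‖ξ‖) := by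
                gcongr
                exact ContinuousLinearMap.le_opNorm _ _
            _ = ‖Θ OperatorSystem.unit x x‖ * ‖ξ‖ ^ 2 := by ring
      map_add' := fun x y => by
        ext ξ
        simp
      map_smul' := fun c x => by
        ext ξ
        simp }
  have hV : ∀ x ξ, V x ξ = ι (x ⊗ₜ ξ) := fun _ _ => rfl
  refine ⟨K, inferInstance, inferInstance, inferInstance, V, ψ, hψ, fun s y x => ?_,
    fun k k' h => ?_⟩
  · ext ξ
    refine ext_inner_left ℂ fun η => ?_
    rw [ContinuousLinearMap.comp_apply, ContinuousLinearMap.adjoint_inner_right,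
      ContinuousLinearMap.comp_apply, hV, hV, hinner, tensorForm_tmul]
  · refine eq_of_inner_dense hι fun v => ?_
    induction v with
    | zero => simp
    | tmul y η =>
      rw [← hV, ← ContinuousLinearMap.adjoint_inner_right, h y,
        ContinuousLinearMap.adjoint_inner_right]
    | add v w hv hw => rw [map_add, inner_add_left, inner_add_left, hv, hw]

omit [AddCommGroup X] [Module ℂ X] in
/-- Operators on `K` are determined by their compositions with the `V x`, if these are jointly
dense in the sense of `exists_dilation`. -/
theorem eq_of_adjoint_separating {K L : Type*} [NormedAddCommGroup K] [InnerProductSpace ℂ K]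
    [CompleteSpace K] [NormedAddCommGroup L] [InnerProductSpace ℂ L] [CompleteSpace L]
    [CompleteSpace Y] {V : X → (Y →L[ℂ] K)}
    (hV : ∀ k k' : K, (∀ y, ContinuousLinearMap.adjoint (V y) k =
      ContinuousLinearMap.adjoint (V y) k') → k = k')
    {T T' : K →L[ℂ] L} (h : ∀ x, T ∘L V x = T' ∘L V x) : T = T' := by
  refine ContinuousLinearMap.adjoint.injective ?_
  ext1 l
  refine hV _ _ fun y => ?_
  have := congrArg (fun R => ContinuousLinearMap.adjoint R l) (h y)
  simpa [ContinuousLinearMap.adjoint_comp] using this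

end Dilation

/-! ### Operator modules over C*-algebras -/

section CStar

theorem eq_zero_of_sum_star_mul_self {C ι : Type*} [CStarAlgebra C] [Fintype ι] {z : ι → C}
    (h : ∑ k, star (z k) * z k = 0) (k : ι) : z k = 0 := by
  let _ := CStarAlgebra.spectralOrder C
  have := CStarAlgebra.spectralOrderedRing C
  rw [Finset.sum_eq_zero_iff_of_nonneg fun _ _ => star_mul_self_nonneg _] at h
  exact CStarRing.star_mul_self_eq_zero_iff _ |>.1 (h k (Finset.mem_univ k))

variable {A S C : Type*} [CStarAlgebra A]
  [AddCommGroup S] [Module ℂ S] [StarAddMonoid S] [StarModule ℂ S] [OperatorSystem S]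
  [CStarAlgebra C] {j : S ≃ₗ[ℂ] C}

/-- In an operator `A`-system that is a C*-algebra, the right action of `a` is right multiplication
by `a · e`. -/
theorem IsCStarIdentification.map_op_smul [Module A S] [Module Aᵐᵒᵖ S]
    [IsScalarTower ℂ A S] [IsScalarTower ℂ Aᵐᵒᵖ S] [SMulCommClass A Aᵐᵒᵖ S]
    [OperatorASystem A S] (hj : IsCStarIdentification j) (a : A) (s : S) :
    j (MulOpposite.op a • s) = j s * j (a • OperatorSystem.unit) := by
  -- With `t = j s`, compress the positive matrix `[[t t*, t], [t*, 1]]` by `[[1, 0, 0], [0, 1, a]]`.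
  -- The result is positive and its quadratic form vanishes at `(1, -t*, 0)`, so it annihilates this
  -- vector; the third coordinate is the adjoint of the claim.
  let x : Matrix (Fin 2) (Fin 2) S :=
    !![j.symm (j s * star (j s)), s; star s, OperatorSystem.unit]
  have hx : x ∈ MatrixCone.cone 2 := by
    rw [hj.mem_cone_iff]
    refine ⟨!![star (j s), 1; 0, 0], ?_⟩
    ext p q
    fin_cases p <;> fin_cases q <;>
      simp [x, Matrix.mul_apply, Fin.sum_univ_two, hj.map_unit, hj.map_star]
  have hQ := OperatorASystem.conjMul_mem (!![1, 0, 0; 0, 1, a] : Matrix (Fin 2) (Fin 3) A) hx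
  rw [hj.mem_cone_iff] at hQ
  obtain ⟨z, hz⟩ := hQ
  have hz' := fun p q => congrFun (congrFun hz p) q
  have h00 := hz' 0 0
  have h01 := hz' 0 1
  have h10 := hz' 1 0
  have h11 := hz' 1 1
  have h20 := hz' 2 0
  have h21 := hz' 2 1
  simp [conjMul, x, Fin.sum_univ_two, Matrix.mul_apply, hj.map_unit, hj.map_star]
    at h00 h01 h10 h11 h20 h21
  have hker : ∀ k, z k 0 - z k 1 * star (j s) = 0 := by
    refine eq_zero_of_sum_star_mul_self ?_
    have : ∀ k, star (z k 0 - z k 1 * star (j s)) * (z k 0 - z k 1 * star (j s)) =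
        star (z k 0) * z k 0 - star (z k 0) * z k 1 * star (j s) -
          (j s * (star (z k 1) * z k 0) - j s * (star (z k 1) * z k 1) * star (j s)) := by
      intro k
      simp
      noncomm_ring
    simp_rw [this, Finset.sum_sub_distrib, ← Finset.sum_mul, ← Finset.mul_sum]
    rw [← h00, ← h01, ← h10, ← h11]
    simp
  have hrow : j (star a • star s) = j (star a • OperatorSystem.unit) * star (j s) := by
    rw [h20, h21, Finset.sum_mul]
    refine Finset.sum_congr rfl fun k _ => ?_
    rw [sub_eq_zero.1 (hker k), mul_assoc]
  have := congrArg star hrow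
  rw [star_mul, star_star, ← hj.map_star, ← hj.map_star, OperatorASystem.star_smul,
    OperatorASystem.star_smul, star_star, star_star, OperatorSystem.star_unit] at this
  rw [this, ← OperatorASystem.smul_unit a]

theorem zero_mem_cone (n : ℕ) : (0 : Matrix (Fin n) (Fin n) S) ∈ MatrixCone.cone n := by
  simpa using OperatorSystem.cone_smul le_rfl (diagonal_unit_mem_cone (S := S) n)

/-- `(g_i* g_k)` is positive. To present it as `y* y` with `y` square, put the row `g` on top of
zeros. -/
theorem IsCStarIdentification.row_mem_cone (hj : IsCStarIdentification j) {n : ℕ} (g : Fin n → C) :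
    Matrix.of (fun i k => j.symm (star (g i) * g k)) ∈ MatrixCone.cone n := by
  cases n with
  | zero =>
    rw [Subsingleton.elim (Matrix.of _) 0]
    exact zero_mem_cone 0
  | succ n =>
    rw [hj.mem_cone_iff]
    refine ⟨Matrix.of fun p i => if p = 0 then g i else 0, ?_⟩
    ext i k
    simp [Matrix.mul_apply]

/-- `c* s c` is positive for `s ∈ M_m(S)⁺` and a rectangular matrix `c` over the C*-algebra. It is a
sum of positive matrices of rank one because `cstarCone` only involves square matrices. -/
theorem IsCStarIdentification.conj_mem_cone (hj : IsCStarIdentification j) {m n : ℕ}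
    {s : Matrix (Fin m) (Fin m) S} (hs : s ∈ MatrixCone.cone m) (c : Matrix (Fin m) (Fin n) C) :
    Matrix.of (fun i k => ∑ p, ∑ q, j.symm (star (c p i) * j (s p q) * c q k)) ∈
      MatrixCone.cone n := by
  rw [hj.mem_cone_iff] at hs
  obtain ⟨y, hy⟩ := hs
  have hsum : Matrix.of (fun i k => ∑ p, ∑ q, j.symm (star (c p i) * j (s p q) * c q k)) =
      ∑ r, Matrix.of (fun i k => j.symm (star ((y * c) r i) * (y * c) r k)) := by
    have hy' : ∀ p q, j (s p q) = ∑ r, star (y r p) * y r q := fun p q => by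
      have := congrFun (congrFun hy p) q
      simpa [Matrix.mul_apply] using this
    ext i k
    rw [Matrix.sum_apply]
    simp only [Matrix.of_apply, ← map_sum]
    congr 1
    simp only [hy', Matrix.mul_apply, star_sum, star_mul, Finset.mul_sum, Finset.sum_mul]
    rw [Finset.sum_comm]
    refine (Finset.sum_congr rfl fun _ _ => Finset.sum_comm).trans ?_
    rw [Finset.sum_comm]
    simp only [mul_assoc]
  rw [hsum]
  exact Finset.sum_induction _ (· ∈ MatrixCone.cone n) (fun _ _ => OperatorSystem.cone_add)
    (zero_mem_cone n) fun r _ => hj.row_mem_cone _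

end CStar

/-! ### Stinespring's theorem -/

section Stinespring

variable {S : Type*} [AddCommGroup S] [Module ℂ S] [StarAddMonoid S] [StarModule ℂ S]
  [OperatorSystem S]

/-- Stinespring's theorem. The family `V` stands for `V c = ρ(c) W` with `W = V 1` the usual isometry;
the last clause expresses minimality. -/
theorem IsUCP.exists_stinespring {K : Type v} [NormedAddCommGroup K] [InnerProductSpace ℂ K]
    [CompleteSpace K] {ψ : S →ₗ[ℂ] (K →L[ℂ] K)} (hψ : IsUCP ψ) {C : Type u} [CStarAlgebra C]
    {j : S ≃ₗ[ℂ] C} (hj : IsCStarIdentification j) :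
    ∃ (L : Type (max u v)) (_ : NormedAddCommGroup L) (_ : InnerProductSpace ℂ L)
      (_ : CompleteSpace L) (V : C →ₗ[ℂ] (K →L[ℂ] L)) (Ψ : S →ₗ[ℂ] (L →L[ℂ] L))
      (ρ : C →⋆ₐ[ℂ] (L →L[ℂ] L)), IsUCP Ψ ∧ (∀ s, Ψ s = ρ (j s)) ∧
      (∀ s d c, ContinuousLinearMap.adjoint (V d) ∘L Ψ s ∘L V c =
        ψ (j.symm (star d * j s * c))) ∧
      ∀ l l' : L, (∀ d, ContinuousLinearMap.adjoint (V d) l = ContinuousLinearMap.adjoint (V d) l')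
        → l = l' := by
  let Θ : S →ₗ[ℂ] C →ₗ⋆[ℂ] C →ₗ[ℂ] (K →L[ℂ] K) :=
    { toFun := fun s => LinearMap.mk₂'ₛₗ (starRingEnd ℂ) (RingHom.id ℂ)
        (fun d c => ψ (j.symm (star d * j s * c)))
        (fun _ _ _ => by simp [add_mul]) (fun _ _ _ => by simp)
        (fun _ _ _ => by simp [mul_add]) (fun _ _ _ => by simp)
      map_add' := fun s s' => by
        ext1 d
        ext1 c
        simp [mul_add, add_mul]
      map_smul' := fun c s => by
        ext1 d
        ext1 c
        simp }
  have hΘ : ∀ s d c, Θ s d c = ψ (j.symm (star d * j s * c)) := fun _ _ _ => rfl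
  obtain ⟨L, _, _, _, V, Ψ, hΨ, hfac, hsep⟩ := exists_dilation Θ fun m n s c hs => by
    convert hψ.1.2 n _ (hj.conj_mem_cone hs c) using 1
    ext1 i k
    simp [hΘ]
  have hmul : ∀ c d : C, Ψ (j.symm c) ∘L V d = V (c * d) := by
    intro c d
    ext ξ
    refine hsep _ _ fun d' => ?_
    have h1 := congrArg (fun R => R ξ) (hfac (j.symm c) d' d)
    have h2 := congrArg (fun R => R ξ) (hfac OperatorSystem.unit d' (c * d))
    rw [hΨ.2] at h2
    refine (h1.trans ?_).trans h2.symm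
    simp [hΘ, hj.map_unit, mul_assoc]
  let ρ : C →⋆ₐ[ℂ] (L →L[ℂ] L) :=
    { toFun := fun c => Ψ (j.symm c)
      map_one' := by rw [← hj.map_unit, j.symm_apply_apply, hΨ.2]
      map_mul' := fun c c' => eq_of_adjoint_separating hsep fun d => by
        rw [hmul, ContinuousLinearMap.mul_def, ContinuousLinearMap.comp_assoc, hmul, hmul,
          mul_assoc]
      map_zero' := by simp
      map_add' := fun _ _ => by simp
      commutes' := fun c => by
        rw [Algebra.algebraMap_eq_smul_one, ← hj.map_unit, map_smul, j.symm_apply_apply, map_smul,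
          hΨ.2, Algebra.algebraMap_eq_smul_one]
      map_star' := fun c => by
        rw [← hΨ.1.1]
        congr 1
        rw [j.symm_apply_eq, hj.map_star, j.apply_symm_apply] }
  exact ⟨L, inferInstance, inferInstance, inferInstance, V, Ψ, ρ, hΨ, fun s => by
    change Ψ s = Ψ (j.symm (j s))
    rw [j.symm_apply_apply], hfac, hsep⟩

end Stinespring

/-! ### Factorisation of trilinear maps -/

section Factorisation

variable {A : Type*} {E : Type u} {S : Type*} {H : Type v}
    [CStarAlgebra A]
    [AddCommGroup E] [Module ℂ E] [OperatorSpace E] [Module A E]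
    [AddCommGroup S] [Module ℂ S] [StarAddMonoid S] [StarModule ℂ S] [OperatorSystem S]
    [Module A S] [Module Aᵐᵒᵖ S]
    [NormedAddCommGroup H] [InnerProductSpace ℂ H] [CompleteSpace H]

/-- A trilinear map on `E* × S × E` as a family of sesquilinear maps on `E`, indexed by `S`. -/
def sesqOfTri (θ : AdjointSpace E →ₗ[ℂ] S →ₗ[ℂ] E →ₗ[ℂ] (H →L[ℂ] H)) :
    S →ₗ[ℂ] E →ₗ⋆[ℂ] E →ₗ[ℂ] (H →L[ℂ] H) where
  toFun s :=
    { toFun := fun y => θ (adj y) s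
      map_add' := fun y y' => by simp
      map_smul' := fun c y => by
        have : adj (c • y) = star c • adj y := by
          change _ = adj (star (star c) • y)
          rw [star_star]
        rw [this, map_smul]
        rfl }
  map_add' s s' := by
    ext1 y
    simp
  map_smul' c s := by
    ext1 y
    simp

/-- The factorisation through the dilation space, in which the vectors `φ(x) ξ` are total.
Admissibility holds since `φ(y)* ψ(s · a) φ(x) = θ(y*, s · a, x) = θ(y*, s, a · x)`. -/
theorem exists_minimal_factorisation {θ : AdjointSpace E →ₗ[ℂ] S →ₗ[ℂ] E →ₗ[ℂ] (H →L[ℂ] H)}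
    (hcb : IsTriCB θ) (hcp : IsTriCP θ) (hbal : IsBalanced A θ) :
    ∃ (K : Type (max u v)) (_ : NormedAddCommGroup K) (_ : InnerProductSpace ℂ K)
      (_ : CompleteSpace K) (φ : E →ₗ[ℂ] (H →L[ℂ] K)) (ψ : S →ₗ[ℂ] (K →L[ℂ] K)),
      IsAdmissible A φ ψ ∧ FactorsAs θ φ ψ ∧ triCBNorm θ = cbNorm φ ^ 2 ∧
      ∀ k k' : K, (∀ y, ContinuousLinearMap.adjoint (φ y) k = ContinuousLinearMap.adjoint (φ y) k')
        → k = k' := by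
  obtain ⟨K, _, _, _, φ, ψ, hψ, hfac, hsep⟩ := exists_dilation (sesqOfTri θ)
    fun m n s x hs => hcp n m x s hs
  have hfac' : FactorsAs θ φ ψ := fun y s x => (hfac s y x).symm
  obtain ⟨hφ, hnorm⟩ := hfac'.isCB_and_norm_eq hψ hcb
  refine ⟨K, inferInstance, inferInstance, inferInstance, φ, ψ, ⟨hφ, hψ, fun s a x => ?_⟩, hfac',
    hnorm, hsep⟩
  ext ξ
  refine hsep _ _ fun y => ?_
  have h := hbal x y s 1 a
  rw [one_smul, MulOpposite.op_one, one_smul, hfac', hfac'] at h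
  exact congrArg (fun R => R ξ) h

variable [IsScalarTower ℂ A S] [IsScalarTower ℂ Aᵐᵒᵖ S] [SMulCommClass A Aᵐᵒᵖ S]
  [OperatorASystem A S]
  {K : Type*} [NormedAddCommGroup K] [InnerProductSpace ℂ K] [CompleteSpace K]
  {φ : E →ₗ[ℂ] (H →L[ℂ] K)} {ψ : S →ₗ[ℂ] (K →L[ℂ] K)}

/-- On a minimal space, admissibility forces `a ↦ ψ(a · e)` to be a representation of `A`, through
`ψ(a · e) φ(x) = φ(a · x)`. -/
theorem IsAdmissible.exists_rep (h : IsAdmissible A φ ψ)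
    (hsep : ∀ k k' : K, (∀ y, ContinuousLinearMap.adjoint (φ y) k =
      ContinuousLinearMap.adjoint (φ y) k') → k = k') :
    ∃ π : A →⋆ₐ[ℂ] (K →L[ℂ] K), (∀ a : A, π a = ψ (a • OperatorSystem.unit)) ∧
      IsSpaceRep φ π ∧ IsSystemRep ψ π := by
  obtain ⟨hφ, hψ, hadm⟩ := h
  have hφa : ∀ (a : A) (x : E), φ (a • x) = ψ (a • OperatorSystem.unit) ∘L φ x := by
    intro a x
    rw [OperatorASystem.smul_unit, hadm, hψ.2]
    rfl
  have hright : ∀ (a : A) (s : S),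
      ψ (MulOpposite.op a • s) = ψ s ∘L ψ (a • OperatorSystem.unit) := fun a s =>
    eq_of_adjoint_separating hsep fun x => by
      rw [hadm, hφa, ContinuousLinearMap.comp_assoc]
  have hstar : ∀ a : A, ψ (star a • OperatorSystem.unit) =
      star (ψ (a • OperatorSystem.unit)) := by
    intro a
    rw [← hψ.1.1, OperatorASystem.star_smul, OperatorSystem.star_unit, OperatorASystem.smul_unit]
  have hleft : ∀ (a : A) (s : S), ψ (a • s) = ψ (a • OperatorSystem.unit) ∘L ψ s := by
    intro a s
    have := congrArg star (hright (star a) (star s))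
    rw [← hψ.1.1, ← OperatorASystem.star_smul, star_star, ← ContinuousLinearMap.mul_def, star_mul,
      hstar, star_star, hψ.1.1, star_star] at this
    exact this
  let π : A →⋆ₐ[ℂ] (K →L[ℂ] K) :=
    { toFun := fun a => ψ (a • OperatorSystem.unit)
      map_one' := by rw [one_smul, hψ.2]
      map_mul' := fun a b => by
        rw [mul_smul, hleft]
        rfl
      map_zero' := by rw [zero_smul, map_zero]
      map_add' := fun a b => by rw [add_smul, map_add]
      commutes' := fun c => by
        rw [Algebra.algebraMap_eq_smul_one, smul_assoc, one_smul, map_smul, hψ.2,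
          Algebra.algebraMap_eq_smul_one]
      map_star' := hstar }
  exact ⟨π, fun _ => rfl, ⟨hφ, hφa⟩, hψ.1, fun a s => ⟨hleft a s, hright a s⟩⟩

end Factorisation

end OpSpace

end

theorem theoremB {A : Type uA} {E : Type uE} {S : Type uS} {H : Type uH}
    [CStarAlgebra A] [PartialOrder A] [StarOrderedRing A]
    [AddCommGroup E] [Module ℂ E] [OperatorSpace E] [Module A E] [IsScalarTower ℂ A E]
    [LeftOperatorSpace A E]
    [AddCommGroup S] [Module ℂ S] [StarAddMonoid S] [StarModule ℂ S] [OperatorSystem S]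
    [Module A S] [Module Aᵐᵒᵖ S] [IsScalarTower ℂ A S] [IsScalarTower ℂ Aᵐᵒᵖ S] [SMulCommClass A Aᵐᵒᵖ S]
    [OperatorASystem A S]
    [NormedAddCommGroup H] [InnerProductSpace ℂ H] [CompleteSpace H]
    (θ : AdjointSpace E →ₗ[ℂ] S →ₗ[ℂ] E →ₗ[ℂ] (H →L[ℂ] H))
    (hcb : IsTriCB θ) (hcp : IsTriCP θ) (hbal : IsBalanced A θ) :
    -- the factorisation
    (∃ (K : Type (max uE uH)) (_ : NormedAddCommGroup K) (_ : InnerProductSpace ℂ K)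
      (_ : CompleteSpace K) (φ : E →ₗ[ℂ] (H →L[ℂ] K)) (ψ : S →ₗ[ℂ] (K →L[ℂ] K)),
      IsAdmissible A φ ψ ∧ FactorsAs θ φ ψ ∧ triCBNorm θ = cbNorm φ ^ 2) ∧
    -- the case `A ⊆ S`, where the inclusion of `A` into `S` is `a ↦ a · e`
    (Function.Injective (fun a : A => a • (OperatorSystem.unit : S)) →
      ∃ (K : Type (max uE uH)) (_ : NormedAddCommGroup K) (_ : InnerProductSpace ℂ K)
        (_ : CompleteSpace K) (φ : E →ₗ[ℂ] (H →L[ℂ] K)) (ψ : S →ₗ[ℂ] (K →L[ℂ] K)),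
        IsAdmissible A φ ψ ∧ FactorsAs θ φ ψ ∧ triCBNorm θ = cbNorm φ ^ 2 ∧
        ∃ π : A →⋆ₐ[ℂ] (K →L[ℂ] K), (∀ a : A, π a = ψ (a • OperatorSystem.unit)) ∧
          IsSpaceRep φ π ∧ IsSystemRep ψ π) ∧
    -- the case where `S` is a C*-algebra `C`
    (∀ (C : Type uS) [CStarAlgebra C] (j : S ≃ₗ[ℂ] C), IsCStarIdentification j →
      ∃ (K : Type (max uE uS uH)) (_ : NormedAddCommGroup K) (_ : InnerProductSpace ℂ K)
        (_ : CompleteSpace K) (φ : E →ₗ[ℂ] (H →L[ℂ] K)) (ψ : S →ₗ[ℂ] (K →L[ℂ] K)),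
        IsAdmissible A φ ψ ∧ FactorsAs θ φ ψ ∧ triCBNorm θ = cbNorm φ ^ 2 ∧
        ∃ ρ : C →⋆ₐ[ℂ] (K →L[ℂ] K), ∀ s : S, ψ s = ρ (j s)) := by
  obtain ⟨K, _, _, _, φ, ψ, hadm, hfac, hnorm, hsep⟩ := exists_minimal_factorisation hcb hcp hbal
  refine ⟨⟨K, inferInstance, inferInstance, inferInstance, φ, ψ, hadm, hfac, hnorm⟩,
    fun _ => ⟨K, inferInstance, inferInstance, inferInstance, φ, ψ, hadm, hfac, hnorm,
      hadm.exists_rep hsep⟩, fun C _ j hj => ?_⟩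
  -- Stinespring dilation of `ψ`, with `φ` composed with the isometry `V 1`
  obtain ⟨L, _, _, _, V, Ψ, ρ, hΨ, hρ, hV, hsepV⟩ := hadm.2.1.exists_stinespring hj
  let φ' : E →ₗ[ℂ] (H →L[ℂ] L) :=
    { toFun := fun x => V 1 ∘L φ x
      map_add' := fun x y => by simp
      map_smul' := fun c x => by simp }
  have hfac' : FactorsAs θ φ' Ψ := by
    intro y s x
    have h := hV s 1 1
    rw [star_one, one_mul, mul_one, j.symm_apply_apply] at h
    rw [hfac, ← h]
    simp only [φ', LinearMap.coe_mk, AddHom.coe_mk, ContinuousLinearMap.adjoint_comp,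
      ContinuousLinearMap.comp_assoc]
  obtain ⟨hφ', hnorm'⟩ := hfac'.isCB_and_norm_eq hΨ hcb
  refine ⟨L, inferInstance, inferInstance, inferInstance, φ', Ψ, ⟨hφ', hΨ, fun s a x => ?_⟩, hfac',
    hnorm', ρ, hρ⟩
  ext ξ
  refine hsepV _ _ fun d => ?_
  have h1 := congrArg (fun R => R (φ x ξ)) (hV (MulOpposite.op a • s) d 1)
  have h2 := congrArg (fun R => R (φ (a • x) ξ)) (hV s d 1)
  refine (h1.trans ?_).trans h2.symm
  -- right multiplication by `a · e` commutes with left multiplication by `d*`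
  have hmod : star d * j (MulOpposite.op a • s) =
      j (MulOpposite.op a • j.symm (star d * j s)) := by
    rw [hj.map_op_smul, hj.map_op_smul, j.apply_symm_apply, mul_assoc]
  rw [mul_one, mul_one, hmod, j.symm_apply_apply]
  exact congrArg (fun R => R ξ) (hadm.2.2 (j.symm (star d * j s)) a x)
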